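/- Let $p$ be a prime, $n\ge 1$, $A=\mu_n$ a cyclic group of order $p^n$, and $k$ a field of characteristic different from $p$ with a fixed embedding $\iota\colon A\to k^\times$ (for instance $k$ algebraically closed of characteristic $\neq p$). All $p$-groups are finite. For a finite group $G$, an $A$-fibered $G$-set is an $A\times G$-set on which $A$ acts freely with finitely many orbits; $B^A(G)$ is the Grothendieck group of $A$-fibered $G$-sets with respect to disjoint union and $kB^n(G)=k\otimes_{\mathbb Z} B^A(G)$, a commutative ring whose product is induced by $X\cdot Y=$ the set of $A$-orbits on $X\times Y$ under $a(x,y)=(ax,a^{-1}y)$, with actions $a(x,_Ay)=(ax,_Ay)$ and $g(x,_Ay)=(gx,_Agy)$. An $A$-fibered $(H,G)$-biset $X$ acts $k$-linearly $kB^n(G)\to kB^n(H)$ by $[Y]\mapsto[X\otimes_{AG}Y]$, where $X\otimes_{AG}Y$ is the $A$-free part of the set of $A\times G$-orbits on $X\times Y$ under $(a,g)(x,y)=(x(a^{-1},g^{-1}),(a,g)y)$. For $N\unlhd G$, $\mathrm{Def}^G_{G/N}$ is the action of the $(G/N,G)$-biset $G/N$, that is, of $A\times G/N$ with $G/N\times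 G$ acting trivially on $A$. Let $O(G)$ be the intersection of the kernels of all homomorphisms $G\to A$. For $H\le G$ and $h\in H$ let $N_G(H,h)$ be the stabilizer in $G$ of the pair $(H,hO(H))$ under conjugation, and let $s^G_{H,h}\colon kB^n(G)\to k$ be the linear map with $s^G_{H,h}([X])=\sum_{Ax}\iota(\phi_x(h))$, the sum being over the $A$-orbits $Ax$ of $X$ stabilized by $H$, where $\phi_x\colon H\to A$ is defined by $h'x=\phi_x(h')x$. Denote by $e^G_{H,h}$ the primitive idempotent of $kB^n(G)$ such that $s^G_{K,l}(e^G_{H,h})$ is $1$ if $(K,lO(K))$ is $G$-conjugate to $(H,hO(H))$, and $0$ otherwise. Let $\Phi(G)$ be the Frattini subgroup of $G$ and $\overline G=G/\Phi(G)$. (1) For every $p$-group $G$ and every $g\in G$, the idempotents $e^G_{G,g}$ and $e^{\overline G}_{\overline G,g\Phi(G)}$ exist and are unique, and $$\mathrm{Def}^G_{\overline G}\, e^G_{G,g}=\frac{|O(G)|}{|N_G(G,g)|}\cdot|\overline G|\cdot e^{\overline G}_{\overline G,g\Phi(G)}.$$ (2) Let $F$ be a subfunctor of $kB^n$ on $p$-groups,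 that is, a family of subspaces $F(G)\subseteq kB^n(G)$, one for each $p$-group $G$, such that every $A$-fibered $(H,G)$-biset, for $p$-groups $G,H$, maps $F(G)$ into $F(H)$. If $G$ is a minimal group of $F$ (a $p$-group of minimal order with $F(G)\neq 0$), then $G$ is elementary abelian, i.e. abelian with $x^p=1$ for all $x\in G$ (the trivial group included). -/

import Mathlib

open MulAction

universe u v

/-- An `A`-fibered `G`-set: a set with commuting actions of `A` and `G` (that is, an `A × G`-set)
such that the action of `A` is free with finitely many orbits. -/
structure FiberedSet (A G : Type u) [CommGroup A] [Group G] where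
  carrier : Type u
  [actA : MulAction A carrier]
  [actG : MulAction G carrier]
  [comm : SMulCommClass A G carrier]
  free : ∀ (a : A) (x : carrier), a • x = x → a = 1
  finite_fibers : Finite (orbitRel.Quotient A carrier)

attribute [instance] FiberedSet.actA FiberedSet.actG FiberedSet.comm FiberedSet.finite_fibers

instance FiberedSet.instCoeSort (A G : Type u) [CommGroup A] [Group G] :
    CoeSort (FiberedSet A G) (Type u) := ⟨FiberedSet.carrier⟩

/-- `O_A(G)`: the intersection of the kernels of all homomorphisms `G → A`. -/
def homKernel (A : Type u) [CommGroup A] (G : Type u) [Group G] : Subgroup G :=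
  ⨅ φ : G →* A, φ.ker

theorem finite_fibers_of_surjective {A α β γ : Type u} [CommGroup A] [MulAction A α]
    [MulAction A β] [MulAction A γ] [Finite (orbitRel.Quotient A α)]
    [Finite (orbitRel.Quotient A β)] (m : α → β → γ)
    (h1 : ∀ (a : A) x y, m (a • x) y = a • m x y) (h2 : ∀ (a : A) x y, m x (a • y) = a • m x y)
    (hs : ∀ c, ∃ x y, m x y = c) : Finite (orbitRel.Quotient A γ) := by
  have hw : ∀ (x₁ : α) (y₁ : β) (x₂ : α) (y₂ : β), orbitRel A α x₁ x₂ → orbitRel A β y₁ y₂ →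
      (Quotient.mk (orbitRel A γ) (m x₁ y₁)) = Quotient.mk (orbitRel A γ) (m x₂ y₂) := by
    rintro _ _ x₂ y₂ ⟨a, rfl⟩ ⟨b, rfl⟩
    refine Quotient.sound ⟨a * b, ?_⟩
    simp only [h1, h2, mul_smul]
  let f : orbitRel.Quotient A α × orbitRel.Quotient A β → orbitRel.Quotient A γ :=
    fun p => Quotient.liftOn₂ p.1 p.2 (fun x y => Quotient.mk (orbitRel A γ) (m x y)) hw
  refine Finite.of_surjective f ?_
  intro c
  induction c using Quotient.inductionOn with
  | h c =>
    obtain ⟨x, y, rfl⟩ := hs c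
    exact ⟨(Quotient.mk _ x, Quotient.mk _ y), rfl⟩

section FiberedBurnside

variable {A G H : Type u} [CommGroup A] [Group G] [Group H]

/-- Isomorphism of `A`-fibered `G`-sets. -/
def FiberedSet.Iso (X Y : FiberedSet A G) : Prop :=
  ∃ f : X → Y, Function.Bijective f ∧ (∀ (a : A) x, f (a • x) = a • f x) ∧
    ∀ (g : G) x, f (g • x) = g • f x

theorem FiberedSet.fibers_sum_finite (X Y : FiberedSet A G) :
    Finite (orbitRel.Quotient A (X ⊕ Y : Type u)) := by
  let f : orbitRel.Quotient A X ⊕ orbitRel.Quotient A Y → orbitRel.Quotient A (X ⊕ Y : Type u) :=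
    Sum.elim
      (Quotient.lift (fun x => Quotient.mk (orbitRel A (X ⊕ Y : Type u)) (Sum.inl x)) (by
        rintro _ x ⟨a, rfl⟩; exact Quotient.sound ⟨a, rfl⟩))
      (Quotient.lift (fun x => Quotient.mk (orbitRel A (X ⊕ Y : Type u)) (Sum.inr x)) (by
        rintro _ x ⟨a, rfl⟩; exact Quotient.sound ⟨a, rfl⟩))
  refine Finite.of_surjective f ?_
  intro c
  induction c using Quotient.inductionOn with
  | h c =>
    rcases c with x | y
    · exact ⟨Sum.inl (Quotient.mk _ x), rfl⟩
    · exact ⟨Sum.inr (Quotient.mk _ y), rfl⟩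

/-- The disjoint union of two `A`-fibered `G`-sets. -/
def FiberedSet.sum (X Y : FiberedSet A G) : FiberedSet A G where
  carrier := X ⊕ Y
  free := by
    rintro a (x | x) h
    · exact X.free a x (Sum.inl_injective h)
    · exact Y.free a x (Sum.inr_injective h)
  finite_fibers := X.fibers_sum_finite Y

variable (k : Type v) [Field k]

/-- The relations of the Grothendieck group: isomorphic fibered sets are identified and
the class of a disjoint union is the sum of the classes. -/
def fiberedBurnsideRel (A G : Type u) [CommGroup A] [Group G] : Set (FiberedSet A G →₀ k) :=
  {r | ∃ X Y : FiberedSet A G, X.Iso Y ∧ r = Finsupp.single X 1 - Finsupp.single Y 1} ∪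
  {r | ∃ X Y : FiberedSet A G,
    r = Finsupp.single (X.sum Y) 1 - Finsupp.single X 1 - Finsupp.single Y 1}

/-- `kB^A(G)`: the Grothendieck group of `A`-fibered `G`-sets with respect to disjoint unions,
with coefficients extended to `k` (presented over `k` by the generators and relations that
present the Grothendieck group over `ℤ`). -/
abbrev FiberedBurnside (A G : Type u) [CommGroup A] [Group G] : Type (max (u + 1) v) :=
  (FiberedSet A G →₀ k) ⧸ Submodule.span k (fiberedBurnsideRel k A G)

/-- The class `[X]` of a fibered set in `kB^A(G)`. -/
noncomputable def FiberedSet.cls (X : FiberedSet A G) : FiberedBurnside k A G :=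
  Submodule.Quotient.mk (Finsupp.single X 1)

theorem FiberedSet.cls_eq_of_iso {X Y : FiberedSet A G} (h : X.Iso Y) : X.cls k = Y.cls k :=
  (Submodule.Quotient.eq _).2 (Submodule.subset_span (Or.inl ⟨X, Y, h, rfl⟩))

theorem FiberedSet.cls_sum (X Y : FiberedSet A G) :
    (X.sum Y).cls k = X.cls k + Y.cls k := by
  unfold FiberedSet.cls
  rw [← Submodule.Quotient.mk_add, Submodule.Quotient.eq, ← sub_sub]
  exact Submodule.subset_span (Or.inr ⟨X, Y, rfl⟩)

variable {k}

/-- Linear extension to `kB^A(G)` of an isomorphism invariant that is additive on disjoint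
unions. -/
noncomputable def FiberedBurnside.lift {M : Type*} [AddCommGroup M] [Module k M]
    (f : FiberedSet A G → M) (hiso : ∀ X Y, X.Iso Y → f X = f Y)
    (hsum : ∀ X Y, f (X.sum Y) = f X + f Y) : FiberedBurnside k A G →ₗ[k] M :=
  Submodule.liftQ _ (Finsupp.linearCombination k f) (by
    rw [Submodule.span_le]
    rintro r (⟨X, Y, h, rfl⟩ | ⟨X, Y, rfl⟩)
    · simp [hiso X Y h]
    · simp [hsum X Y])

theorem FiberedBurnside.lift_cls {M : Type*} [AddCommGroup M] [Module k M]
    (f : FiberedSet A G → M) (hiso : ∀ X Y, X.Iso Y → f X = f Y)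
    (hsum : ∀ X Y, f (X.sum Y) = f X + f Y) (X : FiberedSet A G) :
    FiberedBurnside.lift (k := k) f hiso hsum (X.cls k) = f X := by
  simp [FiberedBurnside.lift, FiberedSet.cls]

theorem FiberedBurnside.hom_ext {M : Type*} [AddCommGroup M] [Module k M]
    {f g : FiberedBurnside k A G →ₗ[k] M} (h : ∀ X : FiberedSet A G, f (X.cls k) = g (X.cls k)) :
    f = g := by
  refine Submodule.linearMap_qext _ (Finsupp.lhom_ext' fun X => LinearMap.ext_ring ?_)
  exact h X

/-! ### The product of the fibered Burnside ring -/

/-- The equivalence relation on `X × Y` whose classes are the `A`-orbits for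
`a · (x, y) = (a x, a⁻¹ y)`. -/
def FiberedSet.mulSetoid (X Y : FiberedSet A G) : Setoid (X × Y : Type u) where
  r p q := ∃ a : A, q = (a • p.1, a⁻¹ • p.2)
  iseqv :=
    { refl := fun p => ⟨1, by simp⟩
      symm := by
        rintro p _ ⟨a, rfl⟩
        exact ⟨a⁻¹, by simp⟩
      trans := by
        rintro p _ _ ⟨a, rfl⟩ ⟨b, rfl⟩
        exact ⟨b * a, by simp [mul_smul, mul_comm b a]; rw [smul_comm]⟩ }

/-- The set of `A`-orbits on `X × Y`. -/
def FiberedSet.MulCarrier (X Y : FiberedSet A G) : Type u := Quotient (X.mulSetoid Y)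

/-- The orbit `(x,_A y)`. -/
def FiberedSet.mulMk (X Y : FiberedSet A G) (x : X) (y : Y) : X.MulCarrier Y :=
  Quotient.mk (X.mulSetoid Y) (x, y)

theorem FiberedSet.mulMk_eq {X Y : FiberedSet A G} {x x' : X} {y y' : Y} :
    X.mulMk Y x y = X.mulMk Y x' y' ↔ ∃ a : A, x' = a • x ∧ y' = a⁻¹ • y := by
  refine (Quotient.eq (r := X.mulSetoid Y)).trans ?_
  change (∃ a : A, (x', y') = (a • x, a⁻¹ • y)) ↔ _
  simp only [Prod.mk.injEq]

theorem FiberedSet.mulMk_surj {X Y : FiberedSet A G} (c : X.MulCarrier Y) :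
    ∃ x y, X.mulMk Y x y = c := by
  obtain ⟨⟨x, y⟩, rfl⟩ := Quotient.exists_rep c
  exact ⟨x, y, rfl⟩

/-- `a · (x,_A y) = (a x,_A y)`. -/
instance FiberedSet.mulActA (X Y : FiberedSet A G) : MulAction A (X.MulCarrier Y) where
  smul a := Quotient.map (fun p => (a • p.1, p.2)) (by
    rintro p _ ⟨b, rfl⟩
    exact ⟨b, by simp [smul_comm a b]⟩)
  one_smul c := by
    obtain ⟨x, y, rfl⟩ := FiberedSet.mulMk_surj c
    change X.mulMk Y _ _ = _
    simp
  mul_smul a b c := by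
    obtain ⟨x, y, rfl⟩ := FiberedSet.mulMk_surj c
    change X.mulMk Y _ _ = X.mulMk Y _ _
    simp [mul_smul]

/-- `g · (x,_A y) = (g x,_A g y)`. -/
instance FiberedSet.mulActG (X Y : FiberedSet A G) : MulAction G (X.MulCarrier Y) where
  smul g := Quotient.map (fun p => (g • p.1, g • p.2)) (by
    rintro p _ ⟨b, rfl⟩
    exact ⟨b, by simp [smul_comm b g, smul_comm b⁻¹ g]⟩)
  one_smul c := by
    obtain ⟨x, y, rfl⟩ := FiberedSet.mulMk_surj c
    change X.mulMk Y _ _ = _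
    simp
  mul_smul a b c := by
    obtain ⟨x, y, rfl⟩ := FiberedSet.mulMk_surj c
    change X.mulMk Y _ _ = X.mulMk Y _ _
    simp [mul_smul]

theorem FiberedSet.smulA_mulMk {X Y : FiberedSet A G} (a : A) (x : X) (y : Y) :
    a • X.mulMk Y x y = X.mulMk Y (a • x) y := rfl

theorem FiberedSet.smulG_mulMk {X Y : FiberedSet A G} (g : G) (x : X) (y : Y) :
    g • X.mulMk Y x y = X.mulMk Y (g • x) (g • y) := rfl

theorem FiberedSet.mulMk_smul {X Y : FiberedSet A G} (a : A) (x : X) (y : Y) :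
    X.mulMk Y x (a • y) = X.mulMk Y (a • x) y :=
  FiberedSet.mulMk_eq.2 ⟨a, rfl, by simp⟩

/-- The product `X · Y` of fibered sets. -/
def FiberedSet.mul (X Y : FiberedSet A G) : FiberedSet A G where
  carrier := X.MulCarrier Y
  comm := ⟨fun a g c => by
    obtain ⟨x, y, rfl⟩ := FiberedSet.mulMk_surj c
    simp only [FiberedSet.smulA_mulMk, FiberedSet.smulG_mulMk, smul_comm a g x]⟩
  free a c h := by
    obtain ⟨x, y, rfl⟩ := FiberedSet.mulMk_surj c
    rw [FiberedSet.smulA_mulMk, FiberedSet.mulMk_eq] at h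
    obtain ⟨b, h1, h2⟩ := h
    have hb : b = 1 := by simpa using Y.free _ _ h2.symm
    subst hb
    exact X.free a x (by simpa using h1.symm)
  finite_fibers := finite_fibers_of_surjective (X.mulMk Y)
    (fun a x y => (FiberedSet.smulA_mulMk a x y).symm)
    (fun a x y => FiberedSet.mulMk_smul a x y) FiberedSet.mulMk_surj

theorem FiberedSet.mul_iso_right (X : FiberedSet A G) {Y Y' : FiberedSet A G} (h : Y.Iso Y') :
    (X.mul Y).Iso (X.mul Y') := by
  obtain ⟨f, hf, hA, hG⟩ := h
  refine ⟨Quotient.map (fun p => (p.1, f p.2)) ?_, ⟨?_, ?_⟩, ?_, ?_⟩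
  · rintro p _ ⟨a, rfl⟩
    exact ⟨a, by simp [hA]⟩
  · intro c d hcd
    obtain ⟨x, y, rfl⟩ := FiberedSet.mulMk_surj c
    obtain ⟨x', y', rfl⟩ := FiberedSet.mulMk_surj d
    change X.mulMk Y' x (f y) = X.mulMk Y' x' (f y') at hcd
    obtain ⟨a, h1, h2⟩ := FiberedSet.mulMk_eq.1 hcd
    exact FiberedSet.mulMk_eq.2 ⟨a, h1, hf.1 (by rw [h2, hA])⟩
  · intro c
    obtain ⟨x, y, rfl⟩ := FiberedSet.mulMk_surj c
    obtain ⟨y, rfl⟩ := hf.2 y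
    exact ⟨X.mulMk Y x y, rfl⟩
  · intro a c
    obtain ⟨x, y, rfl⟩ := FiberedSet.mulMk_surj c
    rfl
  · intro g c
    obtain ⟨x, y, rfl⟩ := FiberedSet.mulMk_surj c
    change X.mulMk Y' (g • x) (f (g • y)) = X.mulMk Y' (g • x) (g • f y)
    rw [hG]

theorem FiberedSet.mul_comm_iso (X Y : FiberedSet A G) : (X.mul Y).Iso (Y.mul X) := by
  refine ⟨Quotient.map (fun p => (p.2, p.1)) ?_, ⟨?_, ?_⟩, ?_, ?_⟩
  · rintro p _ ⟨a, rfl⟩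
    exact ⟨a⁻¹, by simp⟩
  · intro c d hcd
    obtain ⟨x, y, rfl⟩ := FiberedSet.mulMk_surj c
    obtain ⟨x', y', rfl⟩ := FiberedSet.mulMk_surj d
    change Y.mulMk X y x = Y.mulMk X y' x' at hcd
    obtain ⟨a, h1, h2⟩ := FiberedSet.mulMk_eq.1 hcd
    exact FiberedSet.mulMk_eq.2 ⟨a⁻¹, h2, by simpa using h1⟩
  · intro c
    obtain ⟨y, x, rfl⟩ := FiberedSet.mulMk_surj c
    exact ⟨X.mulMk Y x y, rfl⟩
  · intro a c
    obtain ⟨x, y, rfl⟩ := FiberedSet.mulMk_surj c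
    exact FiberedSet.mulMk_smul (X := Y) (Y := X) a y x
  · intro g c
    obtain ⟨x, y, rfl⟩ := FiberedSet.mulMk_surj c
    rfl

theorem FiberedSet.mul_sum_iso (X Y Y' : FiberedSet A G) :
    ((X.mul Y).sum (X.mul Y')).Iso (X.mul (Y.sum Y')) := by
  let f1 : X.MulCarrier Y → X.MulCarrier (Y.sum Y') :=
    Quotient.map (fun p => (p.1, (Sum.inl p.2 : Y ⊕ Y'))) (by
      rintro p _ ⟨a, rfl⟩
      exact ⟨a, rfl⟩)
  let f2 : X.MulCarrier Y' → X.MulCarrier (Y.sum Y') :=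
    Quotient.map (fun p => (p.1, (Sum.inr p.2 : Y ⊕ Y'))) (by
      rintro p _ ⟨a, rfl⟩
      exact ⟨a, rfl⟩)
  refine ⟨Sum.elim f1 f2, ⟨?_, ?_⟩, ?_, ?_⟩
  · rintro (c | c) (d | d) hcd <;>
    · obtain ⟨x, y, rfl⟩ := FiberedSet.mulMk_surj c
      obtain ⟨x', y', rfl⟩ := FiberedSet.mulMk_surj d
      obtain ⟨a, h1, h2⟩ := (FiberedSet.mulMk_eq (X := X) (Y := Y.sum Y')).1 hcd
      first
        | exact congrArg Sum.inl (FiberedSet.mulMk_eq.2 ⟨a, h1, Sum.inl_injective h2⟩)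
        | exact congrArg Sum.inr (FiberedSet.mulMk_eq.2 ⟨a, h1, Sum.inr_injective h2⟩)
        | exact absurd h2 (by rintro ⟨⟩)
  · intro c
    obtain ⟨x, y | y, rfl⟩ := FiberedSet.mulMk_surj c
    · exact ⟨Sum.inl (X.mulMk Y x y), rfl⟩
    · exact ⟨Sum.inr (X.mulMk Y' x y), rfl⟩
  · rintro a (c | c) <;>
    · obtain ⟨x, y, rfl⟩ := FiberedSet.mulMk_surj c
      rfl
  · rintro g (c | c) <;>
    · obtain ⟨x, y, rfl⟩ := FiberedSet.mulMk_surj c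
      rfl

/-- Multiplication by the class of a fibered set. -/
noncomputable def FiberedSet.mulLeft (k : Type v) [Field k] (X : FiberedSet A G) :
    FiberedBurnside k A G →ₗ[k] FiberedBurnside k A G :=
  FiberedBurnside.lift (fun Y => (X.mul Y).cls k)
    (fun _ _ h => FiberedSet.cls_eq_of_iso k (X.mul_iso_right h))
    (fun Y Y' => by
      rw [← FiberedSet.cls_eq_of_iso k (X.mul_sum_iso Y Y'), FiberedSet.cls_sum])

theorem FiberedSet.mulLeft_cls (X Y : FiberedSet A G) :
    X.mulLeft k (Y.cls k) = (X.mul Y).cls k :=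
  FiberedBurnside.lift_cls _ _ _ Y

theorem FiberedSet.mulLeft_cls_comm (X Y : FiberedSet A G) :
    X.mulLeft k (Y.cls k) = Y.mulLeft k (X.cls k) := by
  rw [FiberedSet.mulLeft_cls, FiberedSet.mulLeft_cls,
    FiberedSet.cls_eq_of_iso k (X.mul_comm_iso Y)]

/-- The product of the ring `kB^A(G)`: the bilinear map with `[X] · [Y] = [X · Y]`. -/
noncomputable def FiberedBurnside.mul :
    FiberedBurnside k A G →ₗ[k] FiberedBurnside k A G →ₗ[k] FiberedBurnside k A G :=
  FiberedBurnside.lift (fun X => X.mulLeft k)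
    (fun X Y h => FiberedBurnside.hom_ext fun Z => by
      rw [X.mulLeft_cls_comm, Y.mulLeft_cls_comm, FiberedSet.cls_eq_of_iso k h])
    (fun X Y => FiberedBurnside.hom_ext fun Z => by
      rw [FiberedSet.mulLeft_cls_comm, FiberedSet.cls_sum, map_add, LinearMap.add_apply,
        X.mulLeft_cls_comm, Y.mulLeft_cls_comm])

theorem FiberedBurnside.mul_cls (X Y : FiberedSet A G) :
    FiberedBurnside.mul (X.cls k) (Y.cls k) = (X.mul Y).cls k := by
  rw [FiberedBurnside.mul, FiberedBurnside.lift_cls, FiberedSet.mulLeft_cls]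

/-- A primitive idempotent of the commutative ring `kB^A(G)`: a non-zero idempotent `e` such that
`0` and `e` are the only idempotents `f` with `e f = f`. -/
structure IsPrimitiveIdempotent (e : FiberedBurnside k A G) : Prop where
  ne_zero : e ≠ 0
  idem : FiberedBurnside.mul e e = e
  primitive : ∀ f : FiberedBurnside k A G,
    FiberedBurnside.mul f f = f → FiberedBurnside.mul e f = f → f = 0 ∨ f = e

/-! ### Species -/

/-- The fiber `A x` is stabilized by `H`. -/
def FiberedSet.FiberStable (X : FiberedSet A G) (H : Subgroup G) (x : X) : Prop :=
  ∀ h ∈ H, ∃ a : A, h • x = a • x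

/-- For `h` stabilizing the fiber of `x`, the unique `a` with `h x = a x`. -/
noncomputable def FiberedSet.fiberHom (X : FiberedSet A G) (h : G) (x : X) : A :=
  Classical.epsilon fun a : A => h • x = a • x

open Classical in
/-- The contribution of the fiber `A x` to the species at `(H, h)`. -/
noncomputable def FiberedSet.speciesTerm (ι : A →* kˣ) (H : Subgroup G) (h : H)
    (X : FiberedSet A G) (x : X) : k :=
  if X.FiberStable H x then (ι (X.fiberHom (h : G) x) : k) else 0

theorem FiberedSet.smul_eq_iff_of_map {X Y : FiberedSet A G} {x : X} {y : Y}
    (f : X → Y) (hf : Function.Injective f) (hA : ∀ (a : A) x, f (a • x) = a • f x)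
    (hG : ∀ (g : G) x, f (g • x) = g • f x) (h : f x = y) (g : G) (a : A) :
    g • y = a • y ↔ g • x = a • x := by
  rw [← h, ← hA, ← hG, hf.eq_iff]

theorem FiberedSet.speciesTerm_congr (ι : A →* kˣ) (H : Subgroup G) (h : H)
    {X Y : FiberedSet A G} {x : X} {y : Y}
    (e : ∀ (g : G) (a : A), g • y = a • y ↔ g • x = a • x) :
    Y.speciesTerm ι H h y = X.speciesTerm ι H h x := by
  have h1 : Y.FiberStable H y ↔ X.FiberStable H x := by
    unfold FiberedSet.FiberStable
    simp only [e]
  have h2 : Y.fiberHom (h : G) y = X.fiberHom (h : G) x := by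
    unfold FiberedSet.fiberHom
    simp only [e]
  classical
  unfold FiberedSet.speciesTerm
  rw [h2]
  exact if_congr h1 rfl rfl

theorem FiberedSet.speciesTerm_smul (ι : A →* kˣ) (H : Subgroup G) (h : H)
    (X : FiberedSet A G) (b : A) (x : X) :
    X.speciesTerm ι H h (b • x) = X.speciesTerm ι H h x :=
  FiberedSet.speciesTerm_congr ι H h fun g a => by
    rw [← smul_comm b g x, smul_comm a b x]
    exact (MulAction.injective b).eq_iff

/-- The species at `(H, h)` on a fibered set: the sum over the fibers `A x` stabilized by `H`
of `φ_x(h)`, where `φ_x : H → A` is the homomorphism with `h x = φ_x(h) x`. -/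
noncomputable def FiberedSet.species (ι : A →* kˣ) (H : Subgroup G) (h : H)
    (X : FiberedSet A G) : k :=
  ∑ᶠ c : orbitRel.Quotient A X, Quotient.lift (X.speciesTerm ι H h) (by
    rintro _ x ⟨b, rfl⟩
    exact X.speciesTerm_smul ι H h b x) c

theorem FiberedSet.species_iso (ι : A →* kˣ) (H : Subgroup G) (h : H) (X Y : FiberedSet A G)
    (i : X.Iso Y) : X.species ι H h = Y.species ι H h := by
  obtain ⟨f, hf, hA, hG⟩ := i
  let F : orbitRel.Quotient A X → orbitRel.Quotient A Y :=
    Quotient.map f (by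
      rintro _ x ⟨a, rfl⟩
      exact ⟨a, (hA a x).symm⟩)
  have hF : Function.Bijective F := by
    constructor
    · intro c d
      refine Quotient.inductionOn₂ c d fun x y hxy => ?_
      obtain ⟨a, ha⟩ := Quotient.exact hxy
      exact Quotient.sound ⟨a, hf.1 (by rw [hA]; exact ha)⟩
    · intro c
      refine Quotient.inductionOn c fun y => ?_
      obtain ⟨x, rfl⟩ := hf.2 y
      exact ⟨Quotient.mk _ x, rfl⟩
  refine finsum_eq_of_bijective F hF fun c => ?_
  refine Quotient.inductionOn c fun x => ?_
  exact (FiberedSet.speciesTerm_congr ι H h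
    (FiberedSet.smul_eq_iff_of_map f hf.1 hA hG rfl)).symm

theorem FiberedSet.species_sum (ι : A →* kˣ) (H : Subgroup G) (h : H) (X Y : FiberedSet A G) :
    (X.sum Y).species ι H h = X.species ι H h + Y.species ι H h := by
  let f1 : orbitRel.Quotient A X → orbitRel.Quotient A (X.sum Y) :=
    Quotient.map (Sum.inl : X → X ⊕ Y) (by rintro _ x ⟨a, rfl⟩; exact ⟨a, rfl⟩)
  let f2 : orbitRel.Quotient A Y → orbitRel.Quotient A (X.sum Y) :=
    Quotient.map (Sum.inr : Y → X ⊕ Y) (by rintro _ x ⟨a, rfl⟩; exact ⟨a, rfl⟩)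
  have hF : Function.Bijective (Sum.elim f1 f2) := by
    constructor
    · rintro (c | c) (d | d) <;> refine Quotient.inductionOn₂ c d fun x y hxy => ?_ <;>
        obtain ⟨a, ha⟩ := Quotient.exact hxy
      · exact congrArg Sum.inl (Quotient.sound ⟨a, Sum.inl_injective ha⟩)
      · exact absurd ha (by rintro ⟨⟩)
      · exact absurd ha (by rintro ⟨⟩)
      · exact congrArg Sum.inr (Quotient.sound ⟨a, Sum.inr_injective ha⟩)
    · intro c
      refine Quotient.inductionOn c ?_
      rintro (x | x)
      · exact ⟨Sum.inl (Quotient.mk _ x), rfl⟩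
      · exact ⟨Sum.inr (Quotient.mk _ x), rfl⟩
  have := Fintype.ofFinite (orbitRel.Quotient A X)
  have := Fintype.ofFinite (orbitRel.Quotient A Y)
  have := Fintype.ofFinite (orbitRel.Quotient A (X.sum Y))
  unfold FiberedSet.species
  rw [finsum_eq_sum_of_fintype, finsum_eq_sum_of_fintype, finsum_eq_sum_of_fintype,
    ← hF.sum_comp, Fintype.sum_sum_type]
  congr 1 <;> refine Finset.sum_congr rfl fun c _ => ?_ <;>
    refine Quotient.inductionOn c fun x => ?_
  · exact FiberedSet.speciesTerm_congr (X := X) (Y := X.sum Y) ι H h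
      (FiberedSet.smul_eq_iff_of_map (X := X) (Y := X.sum Y) Sum.inl Sum.inl_injective
        (fun _ _ => rfl) (fun _ _ => rfl) rfl)
  · exact FiberedSet.speciesTerm_congr (X := Y) (Y := X.sum Y) ι H h
      (FiberedSet.smul_eq_iff_of_map (X := Y) (Y := X.sum Y) Sum.inr Sum.inr_injective
        (fun _ _ => rfl) (fun _ _ => rfl) rfl)

/-- The species `s^G_{H,h} : kB^A(G) → k`, for a fixed embedding `ι` of `A` into `kˣ`. -/
noncomputable def species (ι : A →* kˣ) (H : Subgroup G) (h : H) : FiberedBurnside k A G →ₗ[k] k :=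
  FiberedBurnside.lift (FiberedSet.species ι H h) (FiberedSet.species_iso ι H h)
    (FiberedSet.species_sum ι H h)

/-- Conjugation by `x` carries the pair `(H, h O(H))` to the pair `(K, l O(K))`. -/
def PairConjBy (A : Type u) [CommGroup A] (x : G) (H : Subgroup G) (h : H) (K : Subgroup G)
    (l : K) : Prop :=
  H.map (MulAut.conj x).toMonoidHom = K ∧
    ∃ o ∈ homKernel A K, x * (h : G) * x⁻¹ = (l : G) * ((o : K) : G)

/-- `N_G(H, h)`: the stabilizer in `G` of the pair `(H, h O(H))` under conjugation. -/
def pairStabilizer (A : Type u) [CommGroup A] (H : Subgroup G) (h : H) : Set G :=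
  {x | PairConjBy A x H h H h}

open Classical in
/-- `e` is the primitive idempotent `e^G_{H,h}` of `kB^A(G)`: the one on which the species
`s^G_{K,l}` takes the value `1` if `(K, l)` is `G`-conjugate to `(H, h)`, and `0` otherwise. -/
structure IsIdempotentAt (ι : A →* kˣ) (H : Subgroup G) (h : H)
    (e : FiberedBurnside k A G) : Prop where
  isPrimitive : IsPrimitiveIdempotent e
  species_eq : ∀ (K : Subgroup G) (l : K),
    species ι K l e = if ∃ x : G, PairConjBy A x H h K l then 1 else 0

/-! ### The action of fibered bisets -/

/-- An `A`-fibered `(H, G)`-biset: an `A`-fibered `H × G`-set, where `(h, g) • x` stands for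
`h · x · g⁻¹`. -/
abbrev FiberedBiset (A H G : Type u) [CommGroup A] [Group H] [Group G] : Type (u + 1) :=
  FiberedSet A (H × G)

/-- The equivalence relation on `X × Y` whose classes are the `A × G`-orbits for
`(a, g) · (x, y) = (x · (a⁻¹, g⁻¹), (a, g) · y)`. -/
def FiberedBiset.amalgSetoid (X : FiberedBiset A H G) (Y : FiberedSet A G) :
    Setoid (X × Y : Type u) where
  r p q := ∃ (a : A) (g : G), q = (a⁻¹ • ((1, g) : H × G) • p.1, a • g • p.2)
  iseqv :=
    { refl := fun p => ⟨1, 1, by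
        change p = ((1 : A)⁻¹ • (1 : H × G) • p.1, _)
        simp⟩
      symm := by
        rintro p _ ⟨a, g, rfl⟩
        refine ⟨a⁻¹, g⁻¹, ?_⟩
        ext
        · rw [smul_comm a⁻¹ ((1, g) : H × G) p.1]
          simp only [smul_smul, Prod.mk_mul_mk, inv_mul_cancel, inv_inv, mul_one]
          change _ = _ • (1 : H × G) • _
          simp [smul_smul]
        · rw [smul_comm a g p.2]
          simp
      trans := by
        rintro p _ _ ⟨a, g, rfl⟩ ⟨b, h, rfl⟩
        refine ⟨b * a, h * g, ?_⟩
        ext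
        · dsimp only
          rw [← smul_comm a⁻¹ ((1, h) : H × G), smul_smul, smul_smul, Prod.mk_mul_mk, one_mul,
            mul_inv]
        · dsimp only
          rw [← smul_comm a h, smul_smul, smul_smul] }

/-- The amalgamated product `X ×_{AG} Y`. -/
def FiberedBiset.Amalg (X : FiberedBiset A H G) (Y : FiberedSet A G) : Type u :=
  Quotient (FiberedBiset.amalgSetoid X Y)

/-- The orbit `(x,_{AG} y)`. -/
def FiberedBiset.mk (X : FiberedBiset A H G) (Y : FiberedSet A G) (x : X) (y : Y) :
    FiberedBiset.Amalg X Y :=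
  Quotient.mk (FiberedBiset.amalgSetoid X Y) (x, y)

theorem FiberedBiset.mk_eq {X : FiberedBiset A H G} {Y : FiberedSet A G} {x x' : X} {y y' : Y} :
    FiberedBiset.mk X Y x y = FiberedBiset.mk X Y x' y' ↔
      ∃ (a : A) (g : G), x' = a⁻¹ • ((1, g) : H × G) • x ∧ y' = a • g • y := by
  refine (Quotient.eq (r := FiberedBiset.amalgSetoid X Y)).trans ?_
  change (∃ (a : A) (g : G), (x', y') = (a⁻¹ • ((1, g) : H × G) • x, a • g • y)) ↔ _
  simp only [Prod.mk.injEq]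

theorem FiberedBiset.mk_surj {X : FiberedBiset A H G} {Y : FiberedSet A G}
    (c : FiberedBiset.Amalg X Y) : ∃ x y, FiberedBiset.mk X Y x y = c := by
  obtain ⟨⟨x, y⟩, rfl⟩ := Quotient.exists_rep c
  exact ⟨x, y, rfl⟩

/-- `a · (x,_{AG} y) = (a x,_{AG} y)`. -/
instance FiberedBiset.amalgActA (X : FiberedBiset A H G) (Y : FiberedSet A G) :
    MulAction A (FiberedBiset.Amalg X Y) where
  smul b := Quotient.map (fun p => (b • p.1, p.2)) (by
    rintro p _ ⟨a, g, rfl⟩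
    refine ⟨a, g, ?_⟩
    dsimp only
    rw [smul_comm b a⁻¹, smul_comm b ((1, g) : H × G)])
  one_smul c := by
    obtain ⟨x, y, rfl⟩ := FiberedBiset.mk_surj c
    change FiberedBiset.mk X Y _ _ = _
    rw [one_smul]
  mul_smul a b c := by
    obtain ⟨x, y, rfl⟩ := FiberedBiset.mk_surj c
    change FiberedBiset.mk X Y _ _ = FiberedBiset.mk X Y _ _
    rw [mul_smul]

/-- `h · (x,_{AG} y) = (h x,_{AG} y)`. -/
instance FiberedBiset.amalgActH (X : FiberedBiset A H G) (Y : FiberedSet A G) :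
    MulAction H (FiberedBiset.Amalg X Y) where
  smul h := Quotient.map (fun p => (((h, 1) : H × G) • p.1, p.2)) (by
    rintro p _ ⟨a, g, rfl⟩
    refine ⟨a, g, ?_⟩
    dsimp only
    rw [← smul_comm a⁻¹ ((h, 1) : H × G)]
    simp [smul_smul])
  one_smul c := by
    obtain ⟨x, y, rfl⟩ := FiberedBiset.mk_surj c
    change FiberedBiset.mk X Y ((1 : H × G) • x) _ = _
    rw [one_smul]
  mul_smul a b c := by
    obtain ⟨x, y, rfl⟩ := FiberedBiset.mk_surj c
    change FiberedBiset.mk X Y _ _ = FiberedBiset.mk X Y _ _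
    simp [smul_smul]

theorem FiberedBiset.smulA_mk {X : FiberedBiset A H G} {Y : FiberedSet A G} (a : A) (x : X)
    (y : Y) : a • FiberedBiset.mk X Y x y = FiberedBiset.mk X Y (a • x) y := rfl

theorem FiberedBiset.smulH_mk {X : FiberedBiset A H G} {Y : FiberedSet A G} (h : H) (x : X)
    (y : Y) : h • FiberedBiset.mk X Y x y = FiberedBiset.mk X Y (((h, 1) : H × G) • x) y := rfl

theorem FiberedBiset.mk_smul {X : FiberedBiset A H G} {Y : FiberedSet A G} (a : A) (x : X)
    (y : Y) : FiberedBiset.mk X Y x (a • y) = FiberedBiset.mk X Y (a • x) y :=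
  FiberedBiset.mk_eq.2 ⟨a⁻¹, 1, by
    change a • x = (a⁻¹)⁻¹ • (1 : H × G) • x
    simp, by
    simp⟩

instance FiberedBiset.amalgComm (X : FiberedBiset A H G) (Y : FiberedSet A G) :
    SMulCommClass A H (FiberedBiset.Amalg X Y) := ⟨fun a h c => by
  obtain ⟨x, y, rfl⟩ := FiberedBiset.mk_surj c
  rw [FiberedBiset.smulH_mk, FiberedBiset.smulA_mk, FiberedBiset.smulA_mk,
    FiberedBiset.smulH_mk, smul_comm a ((h, 1) : H × G) x]⟩

instance FiberedBiset.amalg_finite_fibers (X : FiberedBiset A H G) (Y : FiberedSet A G) :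
    Finite (orbitRel.Quotient A (FiberedBiset.Amalg X Y)) :=
  finite_fibers_of_surjective (FiberedBiset.mk X Y)
    (fun a x y => (FiberedBiset.smulA_mk a x y).symm)
    (fun a x y => FiberedBiset.mk_smul a x y) FiberedBiset.mk_surj

/-- The elements of `X ×_{AG} Y` whose `A`-orbit is free. -/
def FiberedBiset.TensorCarrier (X : FiberedBiset A H G) (Y : FiberedSet A G) : Type u :=
  {c : FiberedBiset.Amalg X Y // ∀ a : A, a • c = c → a = 1}

instance FiberedBiset.tensorActA (X : FiberedBiset A H G) (Y : FiberedSet A G) :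
    MulAction A (FiberedBiset.TensorCarrier X Y) where
  smul a c := ⟨a • c.1, fun b hb => c.2 b (by
    rw [smul_comm] at hb
    exact MulAction.injective a hb)⟩
  one_smul c := Subtype.ext (one_smul A c.1)
  mul_smul a b c := Subtype.ext (mul_smul a b c.1)

instance FiberedBiset.tensorActH (X : FiberedBiset A H G) (Y : FiberedSet A G) :
    MulAction H (FiberedBiset.TensorCarrier X Y) where
  smul h c := ⟨h • c.1, fun b hb => c.2 b (by
    rw [smul_comm] at hb
    exact MulAction.injective h hb)⟩
  one_smul c := Subtype.ext (one_smul H c.1)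
  mul_smul a b c := Subtype.ext (mul_smul a b c.1)

/-- The tensor product `X ⊗_{AG} Y` of an `A`-fibered `(H, G)`-biset with an `A`-fibered
`G`-set: the `A`-free part of `X ×_{AG} Y`. -/
def FiberedBiset.tensor (X : FiberedBiset A H G) (Y : FiberedSet A G) : FiberedSet A H where
  carrier := FiberedBiset.TensorCarrier X Y
  comm := ⟨fun a h c => Subtype.ext (smul_comm a h c.1)⟩
  free a c h := c.2 a (congrArg Subtype.val h)
  finite_fibers := by
    let f : orbitRel.Quotient A (FiberedBiset.TensorCarrier X Y) →
        orbitRel.Quotient A (FiberedBiset.Amalg X Y) :=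
      Quotient.map Subtype.val (by rintro _ x ⟨a, rfl⟩; exact ⟨a, rfl⟩)
    refine Finite.of_injective f fun c d => ?_
    refine Quotient.inductionOn₂ c d fun x y hxy => ?_
    obtain ⟨a, ha⟩ := Quotient.exact hxy
    exact Quotient.sound ⟨a, Subtype.ext ha⟩

/-- The map `X ×_{AG} Y → X ×_{AG} Y'` induced by an equivariant map `Y → Y'`. -/
def FiberedBiset.amalgMap (X : FiberedBiset A H G) {Y Y' : FiberedSet A G} (f : Y → Y')
    (hA : ∀ (a : A) x, f (a • x) = a • f x) (hG : ∀ (g : G) x, f (g • x) = g • f x) :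
    FiberedBiset.Amalg X Y → FiberedBiset.Amalg X Y' :=
  Quotient.map (fun p => (p.1, f p.2)) (by
    rintro p _ ⟨a, g, rfl⟩
    exact ⟨a, g, by simp only [hA, hG]⟩)

theorem FiberedBiset.amalgMap_smulA (X : FiberedBiset A H G) {Y Y' : FiberedSet A G} (f : Y → Y')
    (hA : ∀ (a : A) x, f (a • x) = a • f x) (hG : ∀ (g : G) x, f (g • x) = g • f x) (a : A)
    (c : FiberedBiset.Amalg X Y) :
    FiberedBiset.amalgMap X f hA hG (a • c) = a • FiberedBiset.amalgMap X f hA hG c := by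
  obtain ⟨x, y, rfl⟩ := FiberedBiset.mk_surj c
  rfl

theorem FiberedBiset.amalgMap_smulH (X : FiberedBiset A H G) {Y Y' : FiberedSet A G} (f : Y → Y')
    (hA : ∀ (a : A) x, f (a • x) = a • f x) (hG : ∀ (g : G) x, f (g • x) = g • f x) (h : H)
    (c : FiberedBiset.Amalg X Y) :
    FiberedBiset.amalgMap X f hA hG (h • c) = h • FiberedBiset.amalgMap X f hA hG c := by
  obtain ⟨x, y, rfl⟩ := FiberedBiset.mk_surj c
  rfl

theorem FiberedBiset.amalgMap_injective (X : FiberedBiset A H G) {Y Y' : FiberedSet A G}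
    (f : Y → Y') (hA : ∀ (a : A) x, f (a • x) = a • f x)
    (hG : ∀ (g : G) x, f (g • x) = g • f x) (hf : Function.Injective f) :
    Function.Injective (FiberedBiset.amalgMap X f hA hG) := by
  intro c d hcd
  obtain ⟨x, y, rfl⟩ := FiberedBiset.mk_surj c
  obtain ⟨x', y', rfl⟩ := FiberedBiset.mk_surj d
  obtain ⟨a, g, h1, h2⟩ := FiberedBiset.mk_eq.1
    (show FiberedBiset.mk X Y' x (f y) = FiberedBiset.mk X Y' x' (f y') from hcd)
  exact FiberedBiset.mk_eq.2 ⟨a, g, h1, hf (by rw [h2, hA, hG])⟩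

/-- The map `X ⊗_{AG} Y → X ⊗_{AG} Y'` induced by an injective equivariant map `Y → Y'`. -/
def FiberedBiset.tensorMap (X : FiberedBiset A H G) {Y Y' : FiberedSet A G} (f : Y → Y')
    (hA : ∀ (a : A) x, f (a • x) = a • f x) (hG : ∀ (g : G) x, f (g • x) = g • f x)
    (hf : Function.Injective f) (c : FiberedBiset.tensor X Y) : FiberedBiset.tensor X Y' :=
  ⟨FiberedBiset.amalgMap X f hA hG c.1, fun a ha => c.2 a (by
    rw [← FiberedBiset.amalgMap_smulA] at ha
    exact FiberedBiset.amalgMap_injective X f hA hG hf ha)⟩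

theorem FiberedBiset.tensorMap_injective (X : FiberedBiset A H G) {Y Y' : FiberedSet A G}
    (f : Y → Y') (hA : ∀ (a : A) x, f (a • x) = a • f x)
    (hG : ∀ (g : G) x, f (g • x) = g • f x) (hf : Function.Injective f) :
    Function.Injective (FiberedBiset.tensorMap X f hA hG hf) := fun _ _ h =>
  Subtype.ext (FiberedBiset.amalgMap_injective X f hA hG hf (congrArg Subtype.val h))

theorem FiberedBiset.tensorMap_surj (X : FiberedBiset A H G) {Y Y' : FiberedSet A G}
    (f : Y → Y') (hA : ∀ (a : A) x, f (a • x) = a • f x)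
    (hG : ∀ (g : G) x, f (g • x) = g • f x) (hf : Function.Injective f)
    (c : FiberedBiset.tensor X Y') (x : X) (y : Y) (h : FiberedBiset.mk X Y' x (f y) = c.1) :
    ∃ d, FiberedBiset.tensorMap X f hA hG hf d = c := by
  refine ⟨⟨FiberedBiset.mk X Y x y, fun a ha => c.2 a ?_⟩, Subtype.ext h⟩
  rw [← h]
  exact congrArg (FiberedBiset.amalgMap X f hA hG) ha

theorem FiberedBiset.tensor_iso (X : FiberedBiset A H G) {Y Y' : FiberedSet A G}
    (h : Y.Iso Y') : (FiberedBiset.tensor X Y).Iso (FiberedBiset.tensor X Y') := by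
  obtain ⟨f, hf, hA, hG⟩ := h
  refine ⟨FiberedBiset.tensorMap X f hA hG hf.1,
    ⟨FiberedBiset.tensorMap_injective X f hA hG hf.1, fun c => ?_⟩,
    fun a c => Subtype.ext (FiberedBiset.amalgMap_smulA X f hA hG a c.1),
    fun g c => Subtype.ext (FiberedBiset.amalgMap_smulH X f hA hG g c.1)⟩
  obtain ⟨x, y, h⟩ := FiberedBiset.mk_surj c.1
  obtain ⟨y, rfl⟩ := hf.2 y
  exact FiberedBiset.tensorMap_surj X f hA hG hf.1 c x y h

theorem FiberedBiset.tensor_sum_iso (X : FiberedBiset A H G) (Y Y' : FiberedSet A G) :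
    ((FiberedBiset.tensor X Y).sum (FiberedBiset.tensor X Y')).Iso
      (FiberedBiset.tensor X (Y.sum Y')) := by
  let f1 := FiberedBiset.tensorMap X (Y := Y) (Y' := Y.sum Y') Sum.inl
    (fun _ _ => rfl) (fun _ _ => rfl) Sum.inl_injective
  let f2 := FiberedBiset.tensorMap X (Y := Y') (Y' := Y.sum Y') Sum.inr
    (fun _ _ => rfl) (fun _ _ => rfl) Sum.inr_injective
  have hne : ∀ c d, f1 c ≠ f2 d := by
    intro c d hcd
    obtain ⟨x, y, hc⟩ := FiberedBiset.mk_surj c.1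
    obtain ⟨x', y', hd⟩ := FiberedBiset.mk_surj d.1
    have h := congrArg Subtype.val hcd
    change FiberedBiset.amalgMap X (Y := Y) (Y' := Y.sum Y') Sum.inl
        (fun _ _ => rfl) (fun _ _ => rfl) c.1 =
      FiberedBiset.amalgMap X (Y := Y') (Y' := Y.sum Y') Sum.inr
        (fun _ _ => rfl) (fun _ _ => rfl) d.1 at h
    rw [← hc, ← hd] at h
    obtain ⟨a, g, -, h2⟩ := (FiberedBiset.mk_eq (X := X) (Y := Y.sum Y')).1 h
    exact absurd h2 (by rintro ⟨⟩)
  refine ⟨Sum.elim f1 f2, ⟨?_, ?_⟩, ?_, ?_⟩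
  · rintro (c | c) (d | d) hcd
    · exact congrArg Sum.inl (FiberedBiset.tensorMap_injective X _ (fun _ _ => rfl)
        (fun _ _ => rfl) Sum.inl_injective hcd)
    · exact absurd hcd (hne c d)
    · exact absurd hcd.symm (hne d c)
    · exact congrArg Sum.inr (FiberedBiset.tensorMap_injective X _ (fun _ _ => rfl)
        (fun _ _ => rfl) Sum.inr_injective hcd)
  · intro c
    obtain ⟨x, y | y, h⟩ := FiberedBiset.mk_surj c.1
    · obtain ⟨d, hd⟩ := FiberedBiset.tensorMap_surj X (Y := Y) (Y' := Y.sum Y') Sum.inl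
        (fun _ _ => rfl) (fun _ _ => rfl) Sum.inl_injective c x y h
      exact ⟨Sum.inl d, hd⟩
    · obtain ⟨d, hd⟩ := FiberedBiset.tensorMap_surj X (Y := Y') (Y' := Y.sum Y') Sum.inr
        (fun _ _ => rfl) (fun _ _ => rfl) Sum.inr_injective c x y h
      exact ⟨Sum.inr d, hd⟩
  · rintro a (c | c)
    · exact Subtype.ext (FiberedBiset.amalgMap_smulA X (Y := Y) (Y' := Y.sum Y') Sum.inl
        (fun _ _ => rfl) (fun _ _ => rfl) a c.1)
    · exact Subtype.ext (FiberedBiset.amalgMap_smulA X (Y := Y') (Y' := Y.sum Y') Sum.inr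
        (fun _ _ => rfl) (fun _ _ => rfl) a c.1)
  · rintro g (c | c)
    · exact Subtype.ext (FiberedBiset.amalgMap_smulH X (Y := Y) (Y' := Y.sum Y') Sum.inl
        (fun _ _ => rfl) (fun _ _ => rfl) g c.1)
    · exact Subtype.ext (FiberedBiset.amalgMap_smulH X (Y := Y') (Y' := Y.sum Y') Sum.inr
        (fun _ _ => rfl) (fun _ _ => rfl) g c.1)

/-- The map `kB^A(X) : kB^A(G) → kB^A(H)` of a fibered biset `X`, with `[Y] ↦ [X ⊗_{AG} Y]`. -/
noncomputable def FiberedBiset.map (k : Type v) [Field k] (X : FiberedBiset A H G) :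
    FiberedBurnside k A G →ₗ[k] FiberedBurnside k A H :=
  FiberedBurnside.lift (fun Y => (FiberedBiset.tensor X Y).cls k)
    (fun _ _ h => FiberedSet.cls_eq_of_iso k (FiberedBiset.tensor_iso X h))
    (fun Y Y' => by
      rw [← FiberedSet.cls_eq_of_iso k (FiberedBiset.tensor_sum_iso X Y Y'),
        FiberedSet.cls_sum])

/-- The underlying set `A × G/N` of the fibered biset of the deflation from `G` to `G/N`. -/
def DeflationCarrier (A : Type u) (N : Subgroup G) : Type u := A × (G ⧸ N)

instance DeflationCarrier.actA (N : Subgroup G) : MulAction A (DeflationCarrier A N) where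
  smul a c := (a * c.1, c.2)
  one_smul c := Prod.ext (one_mul c.1) rfl
  mul_smul a b c := Prod.ext (mul_assoc a b c.1) rfl

/-- `q · (a, c) · g = (a, q c gN)`, that is `(q, g) • (a, c) = (a, q c g⁻¹N)`. -/
instance DeflationCarrier.actG (N : Subgroup G) [N.Normal] :
    MulAction ((G ⧸ N) × G) (DeflationCarrier A N) where
  smul q c := (c.1, q.1 * c.2 * (QuotientGroup.mk q.2)⁻¹)
  one_smul c := Prod.ext rfl (by
    change 1 * c.2 * ((1 : G) : G ⧸ N)⁻¹ = c.2
    simp)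
  mul_smul q r c := Prod.ext rfl (by
    change q.1 * r.1 * c.2 * ((q.2 * r.2 : G) : G ⧸ N)⁻¹ =
      q.1 * (r.1 * c.2 * ((r.2 : G) : G ⧸ N)⁻¹) * ((q.2 : G) : G ⧸ N)⁻¹
    simp [mul_assoc])

/-- The `(G/N, G)`-biset `G/N`, regarded as the `A`-fibered biset `A × G/N` with
`G/N × G` acting trivially on `A`. -/
def deflationBiset (A : Type u) [CommGroup A] [Finite G] (N : Subgroup G) [N.Normal] :
    FiberedBiset A (G ⧸ N) G where
  carrier := DeflationCarrier A N
  comm := ⟨fun _ _ _ => rfl⟩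
  free a c h := mul_eq_right.1 (congrArg Prod.fst h : a * c.1 = c.1)
  finite_fibers := by
    refine Finite.of_surjective
      (fun c : G ⧸ N => Quotient.mk (orbitRel A (DeflationCarrier A N)) ((1, c) : A × (G ⧸ N)))
      fun c => ?_
    refine Quotient.inductionOn c ?_
    rintro ⟨a, c⟩
    exact ⟨c, Quotient.sound ⟨a⁻¹, Prod.ext (inv_mul_cancel a) rfl⟩⟩

/-- The deflation map `Def^G_{G/N} : kB^A(G) → kB^A(G/N)`. -/
noncomputable def deflation (k : Type v) [Field k] (A : Type u) [CommGroup A] [Finite G]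
    (N : Subgroup G) [N.Normal] : FiberedBurnside k A G →ₗ[k] FiberedBurnside k A (G ⧸ N) :=
  FiberedBiset.map k (deflationBiset A N)

end FiberedBurnside

/-! ### Subfunctors and minimal groups -/

/-- A subfunctor of the `A`-fibered `p`-biset functor `kB^A` (defined on finite `p`-groups):
a subspace of each `kB^A(G)`, stable under the action of all fibered bisets. -/
structure BurnsideSubfunctor (p : ℕ) (k : Type v) [Field k] (A : Type u) [CommGroup A] where
  obj : ∀ (G : Type u) [Group G] [Finite G], IsPGroup p G → Submodule k (FiberedBurnside k A G)
  map_mem : ∀ (G H : Type u) [Group G] [Finite G] [Group H] [Finite H] (hG : IsPGroup p G)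
    (hH : IsPGroup p H) (X : FiberedBiset A H G) (x : FiberedBurnside k A G),
    x ∈ obj G hG → FiberedBiset.map k X x ∈ obj H hH

/-- `G` is a minimal group of `F`: a group of minimal order with `F(G) ≠ 0`. -/
def BurnsideSubfunctor.IsMinimalGroup {p : ℕ} {k : Type v} [Field k] {A : Type u} [CommGroup A]
    (F : BurnsideSubfunctor p k A) (G : Type u) [Group G] [Finite G] (hG : IsPGroup p G) : Prop :=
  F.obj G hG ≠ ⊥ ∧ ∀ (H : Type u) [Group H] [Finite H] (hH : IsPGroup p H),
    F.obj H hH ≠ ⊥ → Nat.card G ≤ Nat.card H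

/-- An elementary abelian `p`-group: an abelian group in which `x ^ p = 1` for all `x`. -/
def IsElementaryAbelian (p : ℕ) (G : Type u) [Group G] : Prop :=
  (∀ x y : G, x * y = y * x) ∧ ∀ x : G, x ^ p = 1

/-! All the invariants involved see a fiber `A x` only through its graph, the subgroup of pairs `(g,
a)` of `G × A` with `g x = a x`. Since `A` acts freely, this is the graph of a homomorphism from the
stabilizer of the fiber to `A`. A function `f` of such subgroups, summed over the fibers, extends
linearly to `kB^A(G)` (`FiberedBurnside.graphSum`), and species, decomposition into transitive
classes and species of a deflation all have this form.

Species determine all graph sums: the coefficients of the graphs with projection `V` are found by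
downward induction on `V`, from the linear independence of the characters `V → k`
(`graphCount_eq_zero`). The identity of `kB^A(G)` is itself a graph sum once `|G|` is invertible in
`k`, so the species separate elements (`FiberedBurnside.eq_zero_of_species`). They are also
multiplicative, so a product of elements each separating `(G, g)` from one other pair is the
idempotent at `(G, g)`.

Both claims rest on an averaging formula. For `N ≤ Φ(G)`, the species of `Def x` at `(G/N, lN)` is
the mean over `f ∈ N` of the species of `x` at `(G, l f)` (`species_top_deflation`). Elements of
`Φ(G)` are non-generators, so a proper stabilizer remains proper modulo `N`; a character nontrivial
on `N` gives a non-free orbit, which the tensor product discards, and has mean zero over each coset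
of `N`.

For the first claim, compare species. As `p` divides `|A|`, every maximal subgroup of a `p`-group is
the kernel of a character with values in `A`, whence `O(G) ≤ Φ(G)` and `O(G/Φ(G)) = 1`. The mean at
`l` counts the `f ∈ Φ(G)` with `l f ∈ g O(G)`: there are `|O(G)|` of them if `l ∈ g Φ(G)` and none
otherwise. As `N_G(G, g) = G`, the constant is `|O(G)| / |Φ(G)|`.

For the second claim, suppose `Φ(G) ≠ 1` and `x ∈ F(G)`. By minimality the restrictions of `x` to
proper subgroups vanish, as do the deflations to `G/Φ(G)` of all twists of `x` by characters of `G`.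
The averaging formula makes `g ↦ s_{G,g}(x)` orthogonal to all characters, and Fourier inversion
modulo `O(G)` gives `x = 0`. So `Φ(G) = 1`, and characters of exponent `p` detect all elements of
`G`. -/

/-! ### Graphs of fibers, and linear independence of characters. -/

section GraphSum

variable {A G : Type u} [CommGroup A] [Group G]

/-- The graph of the partial homomorphism `φ_x`: the pairs `(g, a)` with `g x = a x`. -/
def FiberedSet.fiberGraph (X : FiberedSet A G) (x : X) : Subgroup (G × A) where
  carrier := {q | q.1 • x = q.2 • x}
  one_mem' := by simp
  mul_mem' := by
    rintro ⟨g, a⟩ ⟨h, b⟩ (hg : g • x = a • x) (hh : h • x = b • x)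
    change (g * h) • x = (a * b) • x
    rw [mul_smul, hh, ← smul_comm b g, hg, smul_smul, mul_comm]
  inv_mem' := by
    rintro ⟨g, a⟩ (hg : g • x = a • x)
    change g⁻¹ • x = a⁻¹ • x
    rw [inv_smul_eq_iff, ← smul_comm a⁻¹ g, hg, inv_smul_smul]

theorem FiberedSet.mem_fiberGraph {X : FiberedSet A G} {x : X} {q : G × A} :
    q ∈ X.fiberGraph x ↔ q.1 • x = q.2 • x := Iff.rfl

theorem FiberedSet.eq_one_of_mem_fiberGraph {X : FiberedSet A G} {x : X} {a : A}
    (h : ((1 : G), a) ∈ X.fiberGraph x) : a = 1 :=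
  X.free a x (by simpa using (FiberedSet.mem_fiberGraph.1 h).symm)

theorem FiberedSet.fiberGraph_map {X Y : FiberedSet A G} (f : X → Y)
    (hf : Function.Injective f) (hA : ∀ (a : A) x, f (a • x) = a • f x)
    (hG : ∀ (g : G) x, f (g • x) = g • f x) (x : X) :
    Y.fiberGraph (f x) = X.fiberGraph x :=
  Subgroup.ext fun q => FiberedSet.smul_eq_iff_of_map f hf hA hG rfl q.1 q.2

theorem FiberedSet.fiberGraph_smul (X : FiberedSet A G) (b : A) (x : X) :
    X.fiberGraph (b • x) = X.fiberGraph x :=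
  FiberedSet.fiberGraph_map (b • ·) (MulAction.injective b) (fun a x => smul_comm b a x)
    (fun g x => smul_comm b g x) x

/-- The graph attached to a fiber. -/
def FiberedSet.graphOf (X : FiberedSet A G) (c : orbitRel.Quotient A X) : Subgroup (G × A) :=
  Quotient.lift X.fiberGraph (by
    rintro _ x ⟨b, rfl⟩
    exact X.fiberGraph_smul b x) c

@[simp]
theorem FiberedSet.graphOf_mk (X : FiberedSet A G) (x : X) :
    X.graphOf (Quotient.mk _ x) = X.fiberGraph x := rfl

/-- An equivariant bijection induces a bijection on fibers preserving graphs. -/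
theorem FiberedSet.Iso.exists_fiberEquiv {X Y : FiberedSet A G} (i : X.Iso Y) :
    ∃ F : orbitRel.Quotient A X → orbitRel.Quotient A Y, Function.Bijective F ∧
      ∀ c, Y.graphOf (F c) = X.graphOf c := by
  obtain ⟨f, hf, hA, hG⟩ := i
  refine ⟨Quotient.map f (by
      rintro _ x ⟨a, rfl⟩
      exact ⟨a, (hA a x).symm⟩), ⟨?_, ?_⟩, ?_⟩
  · intro c d
    refine Quotient.inductionOn₂ c d fun x y hxy => ?_
    obtain ⟨a, ha⟩ := Quotient.exact hxy
    exact Quotient.sound ⟨a, hf.1 (by rw [hA]; exact ha)⟩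
  · intro c
    refine Quotient.inductionOn c fun y => ?_
    obtain ⟨x, rfl⟩ := hf.2 y
    exact ⟨Quotient.mk _ x, rfl⟩
  · intro c
    refine Quotient.inductionOn c fun x => ?_
    exact FiberedSet.fiberGraph_map f hf.1 hA hG x

/-- The fibers of a disjoint union. -/
theorem FiberedSet.exists_sumFiberEquiv (X Y : FiberedSet A G) :
    ∃ F : orbitRel.Quotient A X ⊕ orbitRel.Quotient A Y → orbitRel.Quotient A (X.sum Y),
      Function.Bijective F ∧ (∀ c, (X.sum Y).graphOf (F (Sum.inl c)) = X.graphOf c) ∧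
      ∀ c, (X.sum Y).graphOf (F (Sum.inr c)) = Y.graphOf c := by
  let f1 : orbitRel.Quotient A X → orbitRel.Quotient A (X.sum Y) :=
    Quotient.map (Sum.inl : X → X ⊕ Y) (by rintro _ x ⟨a, rfl⟩; exact ⟨a, rfl⟩)
  let f2 : orbitRel.Quotient A Y → orbitRel.Quotient A (X.sum Y) :=
    Quotient.map (Sum.inr : Y → X ⊕ Y) (by rintro _ x ⟨a, rfl⟩; exact ⟨a, rfl⟩)
  refine ⟨Sum.elim f1 f2, ⟨?_, ?_⟩, ?_, ?_⟩
  · rintro (c | c) (d | d) <;> refine Quotient.inductionOn₂ c d fun x y hxy => ?_ <;>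
      obtain ⟨a, ha⟩ := Quotient.exact hxy
    · exact congrArg Sum.inl (Quotient.sound ⟨a, Sum.inl_injective ha⟩)
    · exact absurd ha (by rintro ⟨⟩)
    · exact absurd ha (by rintro ⟨⟩)
    · exact congrArg Sum.inr (Quotient.sound ⟨a, Sum.inr_injective ha⟩)
  · intro c
    refine Quotient.inductionOn c ?_
    rintro (x | x)
    · exact ⟨Sum.inl (Quotient.mk _ x), rfl⟩
    · exact ⟨Sum.inr (Quotient.mk _ x), rfl⟩
  · intro c
    refine Quotient.inductionOn c fun x => ?_
    exact FiberedSet.fiberGraph_map (X := X) (Y := X.sum Y) Sum.inl Sum.inl_injective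
      (fun _ _ => rfl) (fun _ _ => rfl) x
  · intro c
    refine Quotient.inductionOn c fun x => ?_
    exact FiberedSet.fiberGraph_map (X := Y) (Y := X.sum Y) Sum.inr Sum.inr_injective
      (fun _ _ => rfl) (fun _ _ => rfl) x

variable {M : Type*} [AddCommGroup M]

/-- The sum over the fibers of a function of their graphs. -/
noncomputable def FiberedSet.graphSum (f : Subgroup (G × A) → M) (X : FiberedSet A G) : M :=
  ∑ᶠ c : orbitRel.Quotient A X, f (X.graphOf c)

theorem FiberedSet.graphSum_iso (f : Subgroup (G × A) → M) (X Y : FiberedSet A G)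
    (i : X.Iso Y) : X.graphSum f = Y.graphSum f := by
  obtain ⟨F, hF, h⟩ := i.exists_fiberEquiv
  exact finsum_eq_of_bijective F hF fun c => by rw [h]

theorem FiberedSet.graphSum_sum (f : Subgroup (G × A) → M) (X Y : FiberedSet A G) :
    (X.sum Y).graphSum f = X.graphSum f + Y.graphSum f := by
  obtain ⟨F, hF, h1, h2⟩ := X.exists_sumFiberEquiv Y
  have := Fintype.ofFinite (orbitRel.Quotient A X)
  have := Fintype.ofFinite (orbitRel.Quotient A Y)
  have := Fintype.ofFinite (orbitRel.Quotient A (X.sum Y))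
  unfold FiberedSet.graphSum
  rw [finsum_eq_sum_of_fintype, finsum_eq_sum_of_fintype, finsum_eq_sum_of_fintype,
    ← hF.sum_comp, Fintype.sum_sum_type]
  simp only [h1, h2]

variable {k : Type v} [Field k] [Module k M]

/-- The linear extension of `FiberedSet.graphSum`. -/
noncomputable def FiberedBurnside.graphSum (f : Subgroup (G × A) → M) :
    FiberedBurnside k A G →ₗ[k] M :=
  FiberedBurnside.lift (FiberedSet.graphSum f) (FiberedSet.graphSum_iso f)
    (FiberedSet.graphSum_sum f)

theorem FiberedBurnside.graphSum_cls (f : Subgroup (G × A) → M) (X : FiberedSet A G) :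
    FiberedBurnside.graphSum f (X.cls k) = ∑ᶠ c, f (X.graphOf c) :=
  FiberedBurnside.lift_cls _ _ _ X

/-- Freeness of `A` makes every graph of a fiber functional, so the values of `f` on other subgroups
are irrelevant. -/
theorem FiberedBurnside.graphSum_congr {f f' : Subgroup (G × A) → M}
    (h : ∀ D : Subgroup (G × A), (∀ a, ((1 : G), a) ∈ D → a = 1) → f D = f' D)
    (x : FiberedBurnside k A G) :
    FiberedBurnside.graphSum f x = FiberedBurnside.graphSum f' x := by
  refine LinearMap.congr_fun (FiberedBurnside.hom_ext fun X => ?_) x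
  rw [FiberedBurnside.graphSum_cls, FiberedBurnside.graphSum_cls]
  refine finsum_congr fun c => ?_
  refine Quotient.inductionOn c fun x => ?_
  exact h _ fun a ha => FiberedSet.eq_one_of_mem_fiberGraph ha

-- Grouping fibers by their type replaces `x` by finitely many coefficients in `k`, the "numbers of
-- fibers of type `d`". These may be arbitrary scalars, since `x` need not be the class of a set.
open Classical in
theorem FiberedBurnside.graphSum_eq_sum {τ : Type*} [Fintype τ]
    (t : Subgroup (G × A) → τ) (f : τ → M) (x : FiberedBurnside k A G) :
    FiberedBurnside.graphSum (fun D => f (t D)) x =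
      ∑ d : τ, FiberedBurnside.graphSum (fun D => if t D = d then (1 : k) else 0) x • f d := by
  suffices h : (FiberedBurnside.graphSum (fun D => f (t D)) : FiberedBurnside k A G →ₗ[k] M) =
      ∑ d : τ, (FiberedBurnside.graphSum fun D => if t D = d then (1 : k) else 0).smulRight
        (f d) by
    rw [h]; simp
  refine FiberedBurnside.hom_ext fun X => ?_
  have := Fintype.ofFinite (orbitRel.Quotient A X)
  simp only [LinearMap.sum_apply, LinearMap.smulRight_apply, FiberedBurnside.graphSum_cls,
    finsum_eq_sum_of_fintype, Finset.sum_smul]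
  rw [Finset.sum_comm]
  simp

open Classical in
/-- The value of `s_{H,h}` on a fiber with a given graph. -/
noncomputable def graphSpecies (ι : A →* kˣ) (H : Subgroup G) (h : G)
    (D : Subgroup (G × A)) : k :=
  if ∀ g ∈ H, ∃ a : A, (g, a) ∈ D then
    (ι (Classical.epsilon fun a : A => (h, a) ∈ D) : k) else 0

theorem species_eq_graphSum (ι : A →* kˣ) (H : Subgroup G) (h : H) :
    species ι H h = FiberedBurnside.graphSum (graphSpecies ι H (h : G)) := by
  refine FiberedBurnside.hom_ext fun X => ?_
  rw [species, FiberedBurnside.lift_cls, FiberedBurnside.graphSum_cls]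
  refine finsum_congr fun c => ?_
  refine Quotient.inductionOn c fun x => ?_
  rfl

theorem graphSpecies_of_not (ι : A →* kˣ) {H : Subgroup G} (h : G) {D : Subgroup (G × A)}
    {g : G} (hg : g ∈ H) (hD : ∀ a, (g, a) ∉ D) : graphSpecies ι H h D = 0 :=
  if_neg fun hH => by
    obtain ⟨a, ha⟩ := hH g hg
    exact hD a ha

theorem Subgroup.snd_unique {D : Subgroup (G × A)} (hD : ∀ a, ((1 : G), a) ∈ D → a = 1)
    {g : G} {a b : A} (ha : (g, a) ∈ D) (hb : (g, b) ∈ D) : a = b := by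
  have := hD (a⁻¹ * b) (by simpa using D.mul_mem (D.inv_mem ha) hb)
  exact (inv_mul_eq_one.1 this)

theorem graphSpecies_of_mem (ι : A →* kˣ) {H : Subgroup G} {h : G} {D : Subgroup (G × A)}
    (hD : ∀ a, ((1 : G), a) ∈ D → a = 1) (hH : ∀ g ∈ H, ∃ a : A, (g, a) ∈ D) {a : A}
    (ha : (h, a) ∈ D) : graphSpecies ι H h D = ι a := by
  rw [graphSpecies, if_pos hH]
  congr 2
  exact Subgroup.snd_unique hD (Classical.epsilon_spec (p := fun a : A => (h, a) ∈ D) ⟨a, ha⟩) ha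

theorem graphSpecies_congr {G' : Type u} [Group G'] (ι : A →* kˣ) {H : Subgroup G}
    {H' : Subgroup G'} {h : G} {h' : G'} {D : Subgroup (G × A)} {D' : Subgroup (G' × A)}
    (e1 : (∀ g ∈ H, ∃ a : A, (g, a) ∈ D) ↔ (∀ g ∈ H', ∃ a : A, (g, a) ∈ D'))
    (e2 : ∀ a, (h, a) ∈ D ↔ (h', a) ∈ D') :
    graphSpecies ι H h D = graphSpecies ι H' h' D' := by
  unfold graphSpecies
  simp only [e2]
  congr 1
  exact propext e1

theorem Subgroup.exists_mem_of_map_fst {D : Subgroup (G × A)} {V : Subgroup G}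
    (hV : D.map (MonoidHom.fst G A) = V) (v : V) : ∃ a, ((v : G), a) ∈ D := by
  subst hV
  obtain ⟨_, ⟨g, a⟩, h, rfl⟩ := v
  exact ⟨a, h⟩

/-- The homomorphism whose graph is a given functional subgroup. -/
noncomputable def Subgroup.graphHom {D : Subgroup (G × A)} (hD : ∀ a, ((1 : G), a) ∈ D → a = 1)
    {V : Subgroup G} (hV : D.map (MonoidHom.fst G A) = V) : V →* A :=
  MonoidHom.mk' (fun v => (Subgroup.exists_mem_of_map_fst hV v).choose) fun v w =>
    Subgroup.snd_unique hD (Subgroup.exists_mem_of_map_fst hV (v * w)).choose_spec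
      (D.mul_mem (Subgroup.exists_mem_of_map_fst hV v).choose_spec
        (Subgroup.exists_mem_of_map_fst hV w).choose_spec)

theorem Subgroup.graphHom_mem {D : Subgroup (G × A)} (hD : ∀ a, ((1 : G), a) ∈ D → a = 1)
    {V : Subgroup G} (hV : D.map (MonoidHom.fst G A) = V) (v : V) :
    ((v : G), Subgroup.graphHom hD hV v) ∈ D :=
  (Subgroup.exists_mem_of_map_fst hV v).choose_spec

theorem Subgroup.mem_iff_graphHom {D : Subgroup (G × A)}
    (hD : ∀ a, ((1 : G), a) ∈ D → a = 1)
    {V : Subgroup G} (hV : D.map (MonoidHom.fst G A) = V) (q : G × A) :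
    q ∈ D ↔ ∃ v : V, (v : G) = q.1 ∧ Subgroup.graphHom hD hV v = q.2 := by
  constructor
  · intro hq
    have hv : q.1 ∈ V := hV ▸ ⟨q, hq, rfl⟩
    exact ⟨⟨q.1, hv⟩, rfl, Subgroup.snd_unique hD (Subgroup.graphHom_mem hD hV ⟨q.1, hv⟩) hq⟩
  · rintro ⟨v, h1, h2⟩
    have := Subgroup.graphHom_mem hD hV v
    rwa [h1, h2] at this

open Classical in
/-- If the species at all pairs `(V, v)` with `V ≤ K` vanish on `x`, then the "number of fibers"
of `x` whose graph restricted to `K` is `D` vanishes for all `D`. -/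
theorem graphCount_eq_zero [Finite A] [Finite G] (ι : A →* kˣ) (hι : Function.Injective ι)
    (K : Subgroup G) (x : FiberedBurnside k A G)
    (hx : ∀ V ≤ K, ∀ v : V, species ι V v x = 0) (D : Subgroup (G × A)) :
    FiberedBurnside.graphSum (fun D' => if D' ⊓ K.prod ⊤ = D then (1 : k) else 0) x = 0 := by
  have := Fintype.ofFinite (Subgroup (G × A))
  set E : Subgroup (G × A) → k := fun D =>
    FiberedBurnside.graphSum (fun D' => if D' ⊓ K.prod ⊤ = D then (1 : k) else 0) x with hE
  -- Such a `D` is never the restriction to `K` of the graph of a fiber.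
  have zero_of : ∀ D : Subgroup (G × A),
      ¬ ((∀ a, ((1 : G), a) ∈ D → a = 1) ∧ D ≤ K.prod ⊤) → E D = 0 := by
    intro D hD
    have h0 : E D = FiberedBurnside.graphSum (fun _ => (0 : k)) x := by
      refine FiberedBurnside.graphSum_congr (fun D' hD' => if_neg fun h => hD ?_) x
      subst h
      exact ⟨fun a ha => hD' a ha.1, inf_le_right⟩
    rw [h0]
    refine LinearMap.congr_fun (g := (0 : FiberedBurnside k A G →ₗ[k] k))
      (FiberedBurnside.hom_ext fun X => ?_) x
    rw [FiberedBurnside.graphSum_cls, finsum_zero, LinearMap.zero_apply]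
  suffices h : ∀ V : Subgroup G, ∀ D, D.map (MonoidHom.fst G A) = V → E D = 0 from h _ D rfl
  intro V
  -- Downward induction: the coefficients of graphs with projection strictly larger than `V` are
  -- already known to vanish.
  induction V using WellFoundedGT.induction with
  | ind V ih =>
  by_cases hVK : V ≤ K
  swap
  · rintro D rfl
    refine zero_of D fun h => hVK ?_
    rintro _ ⟨q, hq, rfl⟩
    exact (h.2 hq).1
  let S := {D : Subgroup (G × A) //
    (∀ a, ((1 : G), a) ∈ D → a = 1) ∧ D.map (MonoidHom.fst G A) = V}
  let χ : S → (V →* k) := fun D =>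
    (Units.coeHom k).comp (ι.comp (Subgroup.graphHom D.2.1 D.2.2))
  have hχ : Function.Injective χ := by
    intro D D' h
    have h' : ∀ v, Subgroup.graphHom D.2.1 D.2.2 v = Subgroup.graphHom D'.2.1 D'.2.2 v :=
      fun v => hι (Units.ext (DFunLike.congr_fun h v))
    refine Subtype.ext (Subgroup.ext fun q => ?_)
    rw [Subgroup.mem_iff_graphHom D.2.1 D.2.2, Subgroup.mem_iff_graphHom D'.2.1 D'.2.2]
    simp only [h']
  -- The graphs over `V` are distinct characters `V → k`, because `ι` is injective; Dedekind's lemma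
  -- makes them independent.
  have hli := (linearIndependent_monoidHom V k).comp χ hχ
  have hS : ∀ D : S, E D.1 = 0 := by
    refine Fintype.linearIndependent_iff.1 hli (fun D => E D.1) (funext fun v => ?_)
    have hs := hx V hVK v
    have hres : ∀ D : Subgroup (G × A),
        graphSpecies ι V (v : G) D = graphSpecies ι V (v : G) (D ⊓ K.prod ⊤) := fun D =>
      graphSpecies_congr ι
        ⟨fun h g hg => (h g hg).imp fun a ha => ⟨ha, hVK hg, trivial⟩,
          fun h g hg => (h g hg).imp fun a ha => ha.1⟩
        fun a => ⟨fun ha => ⟨ha, hVK v.2, trivial⟩, fun ha => ha.1⟩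
    rw [species_eq_graphSum, FiberedBurnside.graphSum_congr (fun D _ => hres D),
      FiberedBurnside.graphSum_eq_sum (fun D : Subgroup (G × A) => D ⊓ K.prod ⊤)
        (graphSpecies ι V (v : G)) x] at hs
    rw [Finset.sum_apply, Pi.zero_apply, ← hs]
    symm
    -- In the expansion of the species at `(V, v)` only functional graphs with projection exactly
    -- `V` survive. Larger projections are removed by induction, and graphs not defined on all of
    -- `V` contribute `0` to the species.
    rw [← Finset.sum_subset (Finset.subset_univ (Finset.univ.filter fun D : Subgroup (G × A) =>
      (∀ a, ((1 : G), a) ∈ D → a = 1) ∧ D.map (MonoidHom.fst G A) = V)),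
      Finset.sum_subtype (p := fun D : Subgroup (G × A) =>
        (∀ a, ((1 : G), a) ∈ D → a = 1) ∧ D.map (MonoidHom.fst G A) = V)]
    · refine Finset.sum_congr rfl fun D _ => ?_
      rw [graphSpecies_of_mem ι D.2.1 (fun g hg => ?_)
        (Subgroup.graphHom_mem D.2.1 D.2.2 v)]
      · rfl
      · exact ⟨_, Subgroup.graphHom_mem D.2.1 D.2.2 ⟨g, hg⟩⟩
    · simp
    · intro D _ hD
      have hD' : ¬ ((∀ a, ((1 : G), a) ∈ D → a = 1) ∧ D.map (MonoidHom.fst G A) = V) := by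
        simpa using hD
      change E D • _ = 0
      by_cases h1 : ∀ a, ((1 : G), a) ∈ D → a = 1
      · by_cases h2 : V ≤ D.map (MonoidHom.fst G A)
        · rw [ih _ (lt_of_le_of_ne h2 fun h => hD' ⟨h1, h.symm⟩) D rfl, zero_smul]
        · obtain ⟨g, hg, hg'⟩ := SetLike.not_le_iff_exists.1 h2
          rw [graphSpecies_of_not ι _ hg fun a ha => hg' ⟨(g, a), ha, rfl⟩, smul_zero]
      · rw [zero_of D fun h => h1 h.1, zero_smul]
  intro D hD
  by_cases h1 : ∀ a, ((1 : G), a) ∈ D → a = 1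
  · exact hS ⟨D, h1, hD⟩
  · exact zero_of D fun h => h1 h.1

/-- A function of the graphs restricted to `K` is determined by the species at the pairs
`(V, v)` with `V ≤ K`. -/
theorem graphSum_eq_zero [Finite A] [Finite G] (ι : A →* kˣ) (hι : Function.Injective ι)
    (K : Subgroup G) (x : FiberedBurnside k A G)
    (hx : ∀ V ≤ K, ∀ v : V, species ι V v x = 0) (f : Subgroup (G × A) → M)
    (hf : ∀ D, f D = f (D ⊓ K.prod ⊤)) : FiberedBurnside.graphSum f x = 0 := by
  have := Fintype.ofFinite (Subgroup (G × A))
  rw [FiberedBurnside.graphSum_congr (fun D _ => hf D),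
    FiberedBurnside.graphSum_eq_sum (fun D : Subgroup (G × A) => D ⊓ K.prod ⊤) f x]
  refine Finset.sum_eq_zero fun D _ => ?_
  rw [graphCount_eq_zero ι hι K x hx D, zero_smul]

end GraphSum

/-! ### Transitive fibered sets, and separation of elements by species. -/

section Orbits

variable {A G : Type u} [CommGroup A] [Group G]

theorem FiberedSet.fiber_eq_iff {X : FiberedSet A G} {x y : X} :
    (Quotient.mk (orbitRel A X) x) = Quotient.mk (orbitRel A X) y ↔ ∃ a : A, x = a • y := by
  rw [Quotient.eq (r := orbitRel A X), orbitRel_apply, mem_orbit_iff]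
  exact exists_congr fun a => eq_comm

theorem FiberedSet.mem_map_fst_fiberGraph {X : FiberedSet A G} {x : X} {g : G} :
    g ∈ (X.fiberGraph x).map (MonoidHom.fst G A) ↔
      Quotient.mk (orbitRel A X) (g • x) = Quotient.mk (orbitRel A X) x := by
  rw [FiberedSet.fiber_eq_iff]
  constructor
  · rintro ⟨⟨g, a⟩, h, rfl⟩
    exact ⟨a, h⟩
  · rintro ⟨a, h⟩
    exact ⟨(g, a), h, rfl⟩

open Classical in
/-- The orbit-stabilizer theorem for the action of a subgroup `N` on fibers. -/
theorem FiberedSet.sum_card_stabilizer [Finite G] (X : FiberedSet A G)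
    [Fintype (orbitRel.Quotient A X)] (N : Subgroup G) (x : X) :
    ∑ c : orbitRel.Quotient A X, (if ∃ n ∈ N, Quotient.mk (orbitRel A X) (n • x) = c then
      Nat.card (N ⊓ (X.graphOf c).map (MonoidHom.fst G A) : Subgroup G) else 0) =
      Nat.card N := by
  -- `N` is partitioned according to the fiber to which `n` moves the fiber of `x`.
  rw [← Nat.card_congr (Equiv.sigmaFiberEquiv
    fun n : N => (Quotient.mk (orbitRel A X) ((n : G) • x) : orbitRel.Quotient A X)),
    Nat.card_sigma]
  refine Finset.sum_congr rfl fun c _ => ?_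
  split_ifs with h
  · obtain ⟨m, hm, rfl⟩ := h
    rw [FiberedSet.graphOf_mk]
    have key : ∀ n : G, n ∈ (X.fiberGraph (m • x)).map (MonoidHom.fst G A) ↔
        Quotient.mk (orbitRel A X) ((n * m) • x) = Quotient.mk (orbitRel A X) (m • x) := by
      intro n
      rw [FiberedSet.mem_map_fst_fiberGraph, mul_smul]
    -- The elements of `N` moving the fiber of `x` to that of `m • x` form the right translate by
    -- `m` of the stabilizer of the latter.
    exact Nat.card_congr
      { toFun := fun n => ⟨⟨n * m, N.mul_mem n.2.1 hm⟩, (key n).1 n.2.2⟩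
        invFun := fun n => ⟨n.1 * m⁻¹, N.mul_mem n.1.2 (N.inv_mem hm),
          (key _).2 (by rw [inv_mul_cancel_right]; exact n.2)⟩
        left_inv := fun n => Subtype.ext (mul_inv_cancel_right _ _)
        right_inv := fun n => Subtype.ext (Subtype.ext (inv_mul_cancel_right _ _)) }
  · refine (@Nat.card_of_isEmpty _ ⟨fun n => h ⟨n.1, n.1.2, n.2⟩⟩).symm

/-- A fibered set is transitive at `x` if `x` meets all orbits of `A × G`. -/
def FiberedSet.TransitiveAt (X : FiberedSet A G) (x : X) : Prop :=
  ∀ y : X, ∃ (a : A) (g : G), y = a • g • x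

theorem FiberedSet.TransitiveAt.trans {X : FiberedSet A G} {x : X} (h : X.TransitiveAt x)
    (y : X) : X.TransitiveAt y := by
  intro z
  obtain ⟨a, g, rfl⟩ := h y
  obtain ⟨b, h, rfl⟩ := h z
  refine ⟨b * a⁻¹, h * g⁻¹, ?_⟩
  rw [← smul_comm a (h * g⁻¹), smul_smul, smul_smul]
  simp

/-- The graph at `x` decides when two translates `a • g • x` and `b • k • x` coincide, so matching
translates of `x` with those of `y` is well defined and injective. -/
theorem FiberedSet.TransitiveAt.iso {X Y : FiberedSet A G} {x : X} {y : Y}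
    (hx : X.TransitiveAt x) (hy : Y.TransitiveAt y) (h : X.fiberGraph x = Y.fiberGraph y) :
    X.Iso Y := by
  have key : ∀ (a b : A) (g k : G), a • g • x = b • k • x ↔ a • g • y = b • k • y := by
    have aux : ∀ (Z : FiberedSet A G) (z : Z) (a b : A) (g k : G),
        a • g • z = b • k • z ↔ (k⁻¹ * g, a⁻¹ * b) ∈ Z.fiberGraph z := by
      intro Z z a b g k
      rw [FiberedSet.mem_fiberGraph, mul_smul, mul_smul, inv_smul_eq_iff, ← smul_comm a⁻¹ k,
        eq_inv_smul_iff, ← smul_comm b k]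
    intro a b g k
    rw [aux, aux, h]
  -- The coordinates of a point are chosen arbitrarily; `hf` shows that the map built from them does
  -- not depend on the choice.
  choose α γ hαγ using hx
  have hf : ∀ (a : A) (g : G), α (a • g • x) • γ (a • g • x) • y = a • g • y := fun a g =>
    ((key _ _ _ _).1 (hαγ (a • g • x))).symm
  refine ⟨fun z => α z • γ z • y, ⟨fun z w hzw => ?_, fun w => ?_⟩, fun b z => ?_,
    fun b z => ?_⟩
  · rw [hαγ z, hαγ w]
    exact (key _ _ _ _).2 hzw
  · obtain ⟨a, g, rfl⟩ := hy w
    exact ⟨a • g • x, hf a g⟩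
  · dsimp only
    conv_lhs => rw [hαγ z]
    rw [smul_smul, hf, mul_smul]
  · dsimp only
    conv_lhs => rw [hαγ z]
    rw [← smul_comm (α z) b, smul_smul b, hf, mul_smul, smul_comm]

/-- The fibered set of the elements satisfying an invariant predicate. -/
def FiberedSet.restrict (X : FiberedSet A G) (P : X → Prop) (hA : ∀ (a : A) x, P (a • x) ↔ P x)
    (hG : ∀ (g : G) x, P (g • x) ↔ P x) : FiberedSet A G where
  carrier := {x : X // P x}
  actA :=
    { smul := fun a x => ⟨a • x.1, (hA a x.1).2 x.2⟩
      one_smul := fun x => Subtype.ext (one_smul A x.1)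
      mul_smul := fun a b x => Subtype.ext (mul_smul a b x.1) }
  actG :=
    { smul := fun a x => ⟨a • x.1, (hG a x.1).2 x.2⟩
      one_smul := fun x => Subtype.ext (one_smul G x.1)
      mul_smul := fun a b x => Subtype.ext (mul_smul a b x.1) }
  comm := by
    let : SMul A {x : X // P x} := ⟨fun a x => ⟨a • x.1, (hA a x.1).2 x.2⟩⟩
    let : SMul G {x : X // P x} := ⟨fun a x => ⟨a • x.1, (hG a x.1).2 x.2⟩⟩
    exact ⟨fun a g x => Subtype.ext (smul_comm a g x.1)⟩
  free a x h := X.free a x.1 (congrArg Subtype.val h)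
  finite_fibers := by
    let : MulAction A {x : X // P x} :=
      { smul := fun a x => ⟨a • x.1, (hA a x.1).2 x.2⟩
        one_smul := fun x => Subtype.ext (one_smul A x.1)
        mul_smul := fun a b x => Subtype.ext (mul_smul a b x.1) }
    let f : orbitRel.Quotient A {x : X // P x} → orbitRel.Quotient A X :=
      Quotient.map Subtype.val (by rintro _ x ⟨a, rfl⟩; exact ⟨a, rfl⟩)
    refine Finite.of_injective f fun c d => ?_
    refine Quotient.inductionOn₂ c d fun x y hxy => ?_
    obtain ⟨a, ha⟩ := Quotient.exact hxy
    exact Quotient.sound ⟨a, Subtype.ext ha⟩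

theorem FiberedSet.restrict_sum_iso (X : FiberedSet A G) (P : X → Prop)
    (hA : ∀ (a : A) x, P (a • x) ↔ P x) (hG : ∀ (g : G) x, P (g • x) ↔ P x) :
    ((X.restrict P hA hG).sum (X.restrict (fun x => ¬ P x) (fun a x => not_congr (hA a x))
      fun g x => not_congr (hG g x))).Iso X := by
  refine ⟨Sum.elim Subtype.val Subtype.val, ⟨?_, fun x => ?_⟩, ?_, ?_⟩
  · rintro (x | x) (y | y) h
    · exact congrArg Sum.inl (Subtype.ext h)
    · exact absurd x.2 (by rw [show x.1 = y.1 from h]; exact y.2)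
    · exact absurd y.2 (by rw [← show x.1 = y.1 from h]; exact x.2)
    · exact congrArg Sum.inr (Subtype.ext h)
  · by_cases h : P x
    · exact ⟨Sum.inl ⟨x, h⟩, rfl⟩
    · exact ⟨Sum.inr ⟨x, h⟩, rfl⟩
  · rintro a (x | x) <;> rfl
  · rintro a (x | x) <;> rfl

theorem FiberedSet.fiberGraph_restrict {X : FiberedSet A G} {P : X → Prop}
    {hA : ∀ (a : A) x, P (a • x) ↔ P x} {hG : ∀ (g : G) x, P (g • x) ↔ P x}
    (x : X.restrict P hA hG) : (X.restrict P hA hG).fiberGraph x = X.fiberGraph x.1 :=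
  (FiberedSet.fiberGraph_map (X := X.restrict P hA hG) (Y := X) Subtype.val
    Subtype.val_injective (fun _ _ => rfl) (fun _ _ => rfl) x).symm

variable {k : Type v} [Field k]

/-- The empty set is isomorphic to two copies of itself, so its class equals its own double. -/
theorem FiberedSet.cls_eq_zero_of_isEmpty (X : FiberedSet A G) [IsEmpty X] : X.cls k = 0 := by
  have h : (X.sum X).Iso X := by
    refine ⟨Sum.elim id id, ⟨?_, fun x => isEmptyElim x⟩, ?_, ?_⟩
    · rintro (x | x) <;> exact isEmptyElim x
    · rintro a (x | x) <;> exact isEmptyElim x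
    · rintro a (x | x) <;> exact isEmptyElim x
  have := FiberedSet.cls_eq_of_iso k h
  rwa [FiberedSet.cls_sum, add_eq_right] at this

/-- Linear maps that agree on the classes of transitive fibered sets are equal. -/
theorem FiberedBurnside.hom_ext_transitive {M : Type*} [AddCommGroup M] [Module k M]
    {f g : FiberedBurnside k A G →ₗ[k] M}
    (h : ∀ (X : FiberedSet A G) (x : X), X.TransitiveAt x → f (X.cls k) = g (X.cls k)) :
    f = g := by
  refine FiberedBurnside.hom_ext fun X => ?_
  induction hn : Nat.card (orbitRel.Quotient A X) using Nat.strong_induction_on generalizing X with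
  | _ n ih =>
  rcases isEmpty_or_nonempty X with hX | ⟨⟨x⟩⟩
  · rw [FiberedSet.cls_eq_zero_of_isEmpty, map_zero, map_zero]
  -- The `A × G`-orbit of `x` is split off; the induction is on the number of fibers.
  let P : X → Prop := fun y => ∃ (a : A) (g : G), y = a • g • x
  have hA : ∀ (a : A) y, P (a • y) ↔ P y := by
    refine fun a y => ⟨?_, ?_⟩
    · rintro ⟨b, g, h⟩
      exact ⟨a⁻¹ * b, g, by rw [mul_smul, ← h, inv_smul_smul]⟩
    · rintro ⟨b, g, rfl⟩
      exact ⟨a * b, g, by rw [mul_smul]⟩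
  have hG : ∀ (g : G) y, P (g • y) ↔ P y := by
    refine fun a y => ⟨?_, ?_⟩
    · rintro ⟨b, g, h⟩
      exact ⟨b, a⁻¹ * g, by rw [mul_smul, smul_comm b a⁻¹, ← h, inv_smul_smul]⟩
    · rintro ⟨b, g, rfl⟩
      exact ⟨b, a * g, by rw [mul_smul, smul_comm b a]⟩
  have hi := X.restrict_sum_iso P hA hG
  set X₁ := X.restrict P hA hG with hX₁
  set X₂ := X.restrict (fun x => ¬ P x) (fun a x => not_congr (hA a x))
      fun g x => not_congr (hG g x) with hX₂
  have hx : P x := ⟨1, 1, by simp⟩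
  rw [← FiberedSet.cls_eq_of_iso k hi, FiberedSet.cls_sum, map_add, map_add]
  congr 1
  · refine h X₁ ⟨x, hx⟩ ?_
    rintro ⟨y, a, g, rfl⟩
    exact ⟨a, g, rfl⟩
  · refine ih _ ?_ X₂ rfl
    obtain ⟨F, hF, -⟩ := hi.exists_fiberEquiv
    obtain ⟨F', hF', -⟩ := X₁.exists_sumFiberEquiv X₂
    rw [← hn, ← Nat.card_eq_of_bijective _ hF, ← Nat.card_eq_of_bijective _ hF', Nat.card_sum]
    have : Nonempty (orbitRel.Quotient A X₁) := ⟨Quotient.mk _ ⟨x, hx⟩⟩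
    have := Nat.card_pos (α := orbitRel.Quotient A X₁)
    omega

open Classical in
/-- The class of a transitive fibered set with a fiber of graph `D` (or zero). -/
noncomputable def transitiveClass (k : Type v) [Field k] (D : Subgroup (G × A)) :
    FiberedBurnside k A G :=
  if h : ∃ (X : FiberedSet A G) (x : X), X.TransitiveAt x ∧ X.fiberGraph x = D then
    h.choose.cls k else 0

theorem FiberedSet.TransitiveAt.transitiveClass_eq {X : FiberedSet A G} {x : X}
    (hx : X.TransitiveAt x) : transitiveClass k (X.fiberGraph x) = X.cls k := by
  have h : ∃ (Y : FiberedSet A G) (y : Y), Y.TransitiveAt y ∧ Y.fiberGraph y = X.fiberGraph x :=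
    ⟨X, x, hx, rfl⟩
  rw [transitiveClass, dif_pos h]
  obtain ⟨y, hy, hyx⟩ := h.choose_spec
  exact FiberedSet.cls_eq_of_iso k (hy.iso hx hyx)

/-- The decomposition of an element of `kB^A(G)` into transitive classes. -/
theorem FiberedBurnside.graphSum_transitiveClass [Finite G] (hk : (Nat.card G : k) ≠ 0)
    (x : FiberedBurnside k A G) :
    FiberedBurnside.graphSum (fun D : Subgroup (G × A) =>
      ((Nat.card (D.map (MonoidHom.fst G A)) : k) / (Nat.card G : k)) •
        transitiveClass k D) x = x := by
  refine LinearMap.congr_fun (g := LinearMap.id)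
    (FiberedBurnside.hom_ext_transitive fun X x hx => ?_) x
  have := Fintype.ofFinite (orbitRel.Quotient A X)
  rw [FiberedBurnside.graphSum_cls, finsum_eq_sum_of_fintype, LinearMap.id_apply]
  have h1 : ∀ c : orbitRel.Quotient A X, transitiveClass k (X.graphOf c) = X.cls k := fun c =>
    Quotient.inductionOn c fun y => (hx.trans y).transitiveClass_eq
  simp only [h1]
  rw [← Finset.sum_smul, ← Finset.sum_div, ← Nat.cast_sum]
  -- In a transitive set all fibers give the same class, and a fiber with stabilizer `S` has weight
  -- `|S| / |G|`, the inverse of the number of fibers. The weights therefore add up to `1`.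
  have h2 := X.sum_card_stabilizer ⊤ x
  rw [Subgroup.card_top] at h2
  have h3 : ∑ c, Nat.card ((X.graphOf c).map (MonoidHom.fst G A)) = Nat.card G := by
    rw [← h2]
    refine Finset.sum_congr rfl fun c _ => ?_
    rw [if_pos, top_inf_eq]
    refine Quotient.inductionOn c fun y => ?_
    obtain ⟨a, g, rfl⟩ := hx y
    exact ⟨g, trivial, (FiberedSet.fiber_eq_iff.2 ⟨a, rfl⟩).symm⟩
  rw [h3, div_self hk, one_smul]

/-- The species separate the elements of `kB^A(G)`. -/
theorem FiberedBurnside.eq_zero_of_species [Finite A] [Finite G] (hk : (Nat.card G : k) ≠ 0)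
    (ι : A →* kˣ) (hι : Function.Injective ι) (x : FiberedBurnside k A G)
    (hx : ∀ (V : Subgroup G) (v : V), species ι V v x = 0) : x = 0 := by
  -- Once `x` is written as a graph sum, the vanishing of graph sums applies with `K = ⊤`, where
  -- restricting the graphs changes nothing.
  rw [← FiberedBurnside.graphSum_transitiveClass hk x]
  exact graphSum_eq_zero ι hι ⊤ x (fun V _ => hx V) _ fun D => by
    rw [Subgroup.top_prod_top, inf_top_eq]

end Orbits

/-! ### Species are multiplicative. -/

section Multiplicativity

variable {A G : Type u} [CommGroup A] [Group G] {k : Type v} [Field k]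

/-- The partial homomorphism of `(x,_A y)` is the product of those of `x` and `y`, defined where
both are. -/
theorem FiberedSet.mem_fiberGraph_mul {X Y : FiberedSet A G} {x : X} {y : Y} {q : G × A} :
    q ∈ (X.mul Y).fiberGraph (X.mulMk Y x y) ↔
      ∃ a b : A, (q.1, a) ∈ X.fiberGraph x ∧ (q.1, b) ∈ Y.fiberGraph y ∧ a * b = q.2 := by
  change q.1 • X.mulMk Y x y = q.2 • X.mulMk Y x y ↔ _
  rw [FiberedSet.smulA_mulMk, FiberedSet.smulG_mulMk, FiberedSet.mulMk_eq]
  simp only [FiberedSet.mem_fiberGraph]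
  constructor
  · rintro ⟨c, h1, h2⟩
    refine ⟨c⁻¹ * q.2, c, ?_, ?_, by simp⟩
    · rw [mul_smul, h1, inv_smul_smul]
    · rw [eq_inv_smul_iff] at h2
      exact h2.symm
  · rintro ⟨a, b, h1, h2, h3⟩
    refine ⟨b, ?_, ?_⟩
    · rw [h1, smul_smul, ← h3, mul_comm]
    · rw [h2, inv_smul_smul]

theorem graphSpecies_mul (ι : A →* kˣ) (H : Subgroup G) (h : H) {D₁ D₂ D : Subgroup (G × A)}
    (h₁ : ∀ a, ((1 : G), a) ∈ D₁ → a = 1) (h₂ : ∀ a, ((1 : G), a) ∈ D₂ → a = 1)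
    (hD : ∀ q : G × A, q ∈ D ↔ ∃ a b : A, (q.1, a) ∈ D₁ ∧ (q.1, b) ∈ D₂ ∧ a * b = q.2) :
    graphSpecies ι H (h : G) D = graphSpecies ι H (h : G) D₁ * graphSpecies ι H (h : G) D₂ := by
  by_cases H₁ : ∀ g ∈ H, ∃ a, (g, a) ∈ D₁
  · by_cases H₂ : ∀ g ∈ H, ∃ a, (g, a) ∈ D₂
    · obtain ⟨a, ha⟩ := H₁ h h.2
      obtain ⟨b, hb⟩ := H₂ h h.2
      rw [graphSpecies_of_mem ι h₁ H₁ ha, graphSpecies_of_mem ι h₂ H₂ hb,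
        graphSpecies_of_mem ι _ _ ((hD (h, a * b)).2 ⟨a, b, ha, hb, rfl⟩)]
      · simp
      · intro c hc
        obtain ⟨a, b, ha, hb, rfl⟩ := (hD _).1 hc
        rw [h₁ a ha, h₂ b hb, mul_one]
      · intro g hg
        obtain ⟨a, ha⟩ := H₁ g hg
        obtain ⟨b, hb⟩ := H₂ g hg
        exact ⟨a * b, (hD _).2 ⟨a, b, ha, hb, rfl⟩⟩
    · push Not at H₂
      obtain ⟨g, hg, hg'⟩ := H₂
      rw [graphSpecies_of_not ι _ hg hg', mul_zero, graphSpecies_of_not ι _ hg]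
      intro c hc
      obtain ⟨a, b, ha, hb, rfl⟩ := (hD _).1 hc
      exact hg' b hb
  · push Not at H₁
    obtain ⟨g, hg, hg'⟩ := H₁
    rw [graphSpecies_of_not ι _ hg hg', zero_mul, graphSpecies_of_not ι _ hg]
    intro c hc
    obtain ⟨a, b, ha, hb, rfl⟩ := (hD _).1 hc
    exact hg' a ha

theorem FiberedSet.exists_mulFiberEquiv (X Y : FiberedSet A G) :
    ∃ F : orbitRel.Quotient A X × orbitRel.Quotient A Y → orbitRel.Quotient A (X.mul Y),
      Function.Bijective F ∧
      ∀ x y, F (Quotient.mk _ x, Quotient.mk _ y) = Quotient.mk _ (X.mulMk Y x y) := by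
  have hw : ∀ (x₁ : X) (y₁ : Y) (x₂ : X) (y₂ : Y), orbitRel A X x₁ x₂ → orbitRel A Y y₁ y₂ →
      (Quotient.mk (orbitRel A (X.mul Y)) (X.mulMk Y x₁ y₁)) =
        Quotient.mk (orbitRel A (X.mul Y)) (X.mulMk Y x₂ y₂) := by
    rintro _ _ x₂ y₂ ⟨a, rfl⟩ ⟨b, rfl⟩
    refine Quotient.sound ⟨a * b, ?_⟩
    change X.mulMk Y ((a * b) • x₂) y₂ = X.mulMk Y (a • x₂) (b • y₂)
    rw [FiberedSet.mulMk_smul, smul_smul, mul_comm]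
  refine ⟨fun p => Quotient.liftOn₂ p.1 p.2 (fun x y => Quotient.mk _ (X.mulMk Y x y)) hw,
    ⟨?_, ?_⟩, fun x y => rfl⟩
  · rintro ⟨c, d⟩ ⟨c', d'⟩
    refine Quotient.inductionOn₂ c d fun x y => Quotient.inductionOn₂ c' d' fun x' y' h => ?_
    obtain ⟨a, ha⟩ := Quotient.exact h
    obtain ⟨b, h1, h2⟩ := (FiberedSet.mulMk_eq (X := X) (Y := Y) (x := a • x') (y := y')).1 ha
    refine Prod.ext (Quotient.sound ⟨b * a, ?_⟩) (Quotient.sound ⟨b⁻¹, h2.symm⟩)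
    change (b * a) • x' = x
    rw [mul_smul, h1]
  · intro c
    refine Quotient.inductionOn c fun z => ?_
    obtain ⟨x, y, rfl⟩ := FiberedSet.mulMk_surj (X := X) (Y := Y) z
    exact ⟨(Quotient.mk _ x, Quotient.mk _ y), rfl⟩

/-- The fibers of `X · Y` are the pairs of fibers, and the contribution of a pair is the product of
the two contributions. -/
theorem species_mul (ι : A →* kˣ) (H : Subgroup G) (h : H) (x y : FiberedBurnside k A G) :
    species ι H h (FiberedBurnside.mul x y) = species ι H h x * species ι H h y := by
  have key : FiberedBurnside.mul.compr₂ (species ι H h) =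
      (LinearMap.mul k k).compl₁₂ (species (A := A) ι H h) (species ι H h) := by
    refine FiberedBurnside.hom_ext fun X => FiberedBurnside.hom_ext fun Y => ?_
    rw [LinearMap.compr₂_apply, LinearMap.compl₁₂_apply, LinearMap.mul_apply',
      FiberedBurnside.mul_cls, species_eq_graphSum]
    have := Fintype.ofFinite (orbitRel.Quotient A X)
    have := Fintype.ofFinite (orbitRel.Quotient A Y)
    have := Fintype.ofFinite (orbitRel.Quotient A (X.mul Y))
    obtain ⟨F, hF, hF'⟩ := X.exists_mulFiberEquiv Y
    simp only [FiberedBurnside.graphSum_cls, finsum_eq_sum_of_fintype]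
    rw [← hF.sum_comp, Fintype.sum_prod_type, Finset.sum_mul_sum]
    refine Finset.sum_congr rfl fun c _ => Finset.sum_congr rfl fun d _ => ?_
    refine Quotient.inductionOn₂ c d fun x y => ?_
    rw [hF']
    exact graphSpecies_mul ι H h (fun a => FiberedSet.eq_one_of_mem_fiberGraph)
      (fun a => FiberedSet.eq_one_of_mem_fiberGraph) fun q => FiberedSet.mem_fiberGraph_mul
  exact LinearMap.congr_fun (LinearMap.congr_fun key x) y

end Multiplicativity

/-! ### Pairs with first component `G`, and test elements of the fibered Burnside ring. -/

section Characters

variable {A G : Type u} [CommGroup A] [Group G]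

theorem mem_homKernel {x : G} : x ∈ homKernel A G ↔ ∀ φ : G →* A, φ x = 1 := by
  simp [homKernel, Subgroup.mem_iInf, MonoidHom.mem_ker]

theorem mem_homKernel_top {x : (⊤ : Subgroup G)} :
    x ∈ homKernel A (⊤ : Subgroup G) ↔ (x : G) ∈ homKernel A G := by
  rw [mem_homKernel, mem_homKernel]
  refine ⟨fun h φ => h (φ.comp (Subgroup.subtype ⊤)), fun h φ => ?_⟩
  exact h (φ.comp (Subgroup.topEquiv (G := G)).symm.toMonoidHom)

/-- As `A` is abelian, characters are invariant under conjugation, so conjugating `g` changes it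
only by an element of `O(G)`. -/
theorem pairConjBy_top_iff {x g : G} {K : Subgroup G} {l : K} :
    PairConjBy A x ⊤ ⟨g, Subgroup.mem_top g⟩ K l ↔
      K = ⊤ ∧ (l : G)⁻¹ * g ∈ homKernel A G := by
  have hmap : (⊤ : Subgroup G).map (MulAut.conj x).toMonoidHom = ⊤ :=
    Subgroup.map_top_of_surjective _ (MulAut.conj x).surjective
  constructor
  · rintro ⟨rfl, o, ho, h⟩
    refine ⟨hmap, ?_⟩
    rw [mem_homKernel]
    intro φ
    have h1 := (mem_homKernel.1 ho) (φ.comp (Subgroup.subtype _))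
    have h2 := congrArg φ h
    simp only [map_mul, map_inv, MonoidHom.coe_comp, Function.comp_apply,
      Subgroup.coe_subtype] at h1 h2 ⊢
    rw [h1, mul_one, mul_comm, inv_mul_cancel_left] at h2
    rw [h2, inv_mul_cancel]
  · rintro ⟨rfl, h⟩
    refine ⟨hmap, ⟨(l : G)⁻¹ * (x * g * x⁻¹), trivial⟩, ?_, by simp⟩
    rw [mem_homKernel_top, mem_homKernel]
    intro φ
    have := mem_homKernel.1 h φ
    simp only [map_mul, map_inv] at this ⊢
    rw [mul_comm (φ x), mul_inv_cancel_right, this]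

theorem pairStabilizer_top (g : G) :
    pairStabilizer A (⊤ : Subgroup G) ⟨g, Subgroup.mem_top g⟩ = Set.univ :=
  Set.eq_univ_of_forall fun _ => pairConjBy_top_iff.2 ⟨rfl, by simp⟩

/-- A functional subgroup of `G × A` is the graph of a character of `G`, or its projection is a
proper subgroup of `G`. -/
theorem Subgroup.graph_cases {D : Subgroup (G × A)} (hD : ∀ a, ((1 : G), a) ∈ D → a = 1) :
    (∃ φ : G →* A, ∀ g a, (g, a) ∈ D ↔ φ g = a) ∨ ∃ g, ∀ a, (g, a) ∉ D := by
  by_cases h : ∃ g, ∀ a, (g, a) ∉ D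
  · exact Or.inr h
  · push Not at h
    have hV : D.map (MonoidHom.fst G A) = ⊤ := by
      refine top_unique fun g _ => ?_
      obtain ⟨a, ha⟩ := h g
      exact ⟨(g, a), ha, rfl⟩
    refine Or.inl ⟨(Subgroup.graphHom hD hV).comp (Subgroup.topEquiv (G := G)).symm.toMonoidHom,
      fun g a => ?_⟩
    rw [Subgroup.mem_iff_graphHom hD hV]
    constructor
    · rintro ⟨v, rfl, rfl⟩
      rfl
    · rintro rfl
      exact ⟨⟨g, trivial⟩, rfl, rfl⟩

variable {k : Type v} [Field k]

theorem graphSpecies_top_of_hom (ι : A →* kˣ) {D : Subgroup (G × A)} {φ : G →* A}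
    (h : ∀ g a, (g, a) ∈ D ↔ φ g = a) (g : G) : graphSpecies ι ⊤ g D = ι (φ g) :=
  graphSpecies_of_mem ι (fun a ha => by rw [← (h _ _).1 ha, map_one])
    (fun g _ => ⟨φ g, (h _ _).2 rfl⟩) ((h _ _).2 rfl)

theorem graphSpecies_top_of_not (ι : A →* kˣ) {D : Subgroup (G × A)} {l : G}
    (h : ∀ a, (l, a) ∉ D) (g : G) : graphSpecies ι ⊤ g D = 0 :=
  graphSpecies_of_not ι g (Subgroup.mem_top l) h

/-- Only fibers stabilized by all of `G` count, and on these `G` acts through a homomorphism to `A`,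
which is trivial on `O(G)`. -/
theorem species_top_congr (ι : A →* kˣ) {g l : G} (h : l⁻¹ * g ∈ homKernel A G)
    (x : FiberedBurnside k A G) :
    species ι ⊤ ⟨l, Subgroup.mem_top l⟩ x = species ι ⊤ ⟨g, Subgroup.mem_top g⟩ x := by
  rw [species_eq_graphSum, species_eq_graphSum]
  refine FiberedBurnside.graphSum_congr (fun D hD => ?_) x
  obtain ⟨φ, hφ⟩ | ⟨m, hm⟩ := Subgroup.graph_cases hD
  · rw [graphSpecies_top_of_hom ι hφ, graphSpecies_top_of_hom ι hφ]
    have := mem_homKernel.1 h φ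
    rw [map_mul, map_inv, inv_mul_eq_one] at this
    simp only [this]
  · rw [graphSpecies_top_of_not ι hm, graphSpecies_top_of_not ι hm]

/-- The fibered set `A` with `G` acting through a character. -/
def characterSet (ν : G →* A) : FiberedSet A G where
  carrier := A
  actA := Monoid.toMulAction A
  actG := MulAction.compHom A ν
  comm := by
    let := MulAction.compHom A ν
    exact ⟨fun a g x => mul_left_comm a (ν g) x⟩
  free a x h := mul_eq_right.1 h
  finite_fibers := by
    refine Finite.of_surjective (fun _ : Unit => Quotient.mk _ (1 : A)) fun c => ?_
    refine Quotient.inductionOn c fun a => ⟨(), Quotient.sound ⟨a⁻¹, inv_mul_cancel a⟩⟩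

theorem species_characterSet (ι : A →* kˣ) (ν : G →* A) (H : Subgroup G) (h : H) :
    species ι H h ((characterSet ν).cls k) = ι (ν h) := by
  rw [species_eq_graphSum, FiberedBurnside.graphSum_cls]
  have hu : ∀ c : orbitRel.Quotient A (characterSet ν), c = Quotient.mk _ (1 : A) := by
    intro c
    refine Quotient.inductionOn c fun a => ?_
    exact Quotient.sound ⟨a, mul_one (M := A) a⟩
  refine (finsum_eq_single (fun c => graphSpecies ι H (h : G) ((characterSet ν).graphOf c)) _
    fun c hc => absurd (hu c) hc).trans ?_
  have hm : ∀ g, (g, ν g) ∈ (characterSet ν).fiberGraph (1 : A) := fun g => rfl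
  exact graphSpecies_of_mem ι (fun a => FiberedSet.eq_one_of_mem_fiberGraph)
    (fun g _ => ⟨_, hm g⟩) (hm h)

/-- The fibered set `A × G/K`. -/
def cosetSet (A : Type u) [CommGroup A] [Finite G] (K : Subgroup G) : FiberedSet A G where
  carrier := A × (G ⧸ K)
  actA :=
    { smul := fun a c => (a * c.1, c.2)
      one_smul := fun c => Prod.ext (one_mul c.1) rfl
      mul_smul := fun a b c => Prod.ext (mul_assoc a b c.1) rfl }
  actG :=
    { smul := fun g c => (c.1, g • c.2)
      one_smul := fun c => Prod.ext rfl (one_smul G c.2)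
      mul_smul := fun g h c => Prod.ext rfl (mul_smul g h c.2) }
  comm := by
    let : SMul A (A × (G ⧸ K)) := ⟨fun a c => (a * c.1, c.2)⟩
    let : SMul G (A × (G ⧸ K)) := ⟨fun g c => (c.1, g • c.2)⟩
    exact ⟨fun a g x => rfl⟩
  free a c h := mul_eq_right.1 (congrArg Prod.fst h : a * c.1 = c.1)
  finite_fibers := by
    let : MulAction A (A × (G ⧸ K)) :=
      { smul := fun a c => (a * c.1, c.2)
        one_smul := fun c => Prod.ext (one_mul c.1) rfl
        mul_smul := fun a b c => Prod.ext (mul_assoc a b c.1) rfl }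
    refine Finite.of_surjective
      (fun c : G ⧸ K => Quotient.mk (orbitRel A (A × (G ⧸ K))) (1, c)) fun c => ?_
    refine Quotient.inductionOn c ?_
    rintro ⟨a, c⟩
    exact ⟨c, Quotient.sound ⟨a⁻¹, Prod.ext (inv_mul_cancel a) rfl⟩⟩

theorem mem_fiberGraph_cosetSet [Finite G] {K : Subgroup G} {c : cosetSet A K} {g : G} {a : A} :
    (g, a) ∈ (cosetSet A K).fiberGraph c ↔ g • c.2 = c.2 ∧ a = 1 := by
  rw [FiberedSet.mem_fiberGraph]
  change ((c.1, g • c.2) : A × (G ⧸ K)) = (a * c.1, c.2) ↔ _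
  rw [Prod.ext_iff]
  change c.1 = a * c.1 ∧ _ ↔ _
  rw [right_eq_mul, and_comm]

/-- `G` fixes no coset of a proper subgroup. This and the next lemma let `A × G/M` separate `G` from
the subgroups of a maximal `M`. -/
theorem species_top_cosetSet [Finite G] (ι : A →* kˣ) {M : Subgroup G} (hM : M ≠ ⊤)
    (g : (⊤ : Subgroup G)) : species ι ⊤ g ((cosetSet A M).cls k) = 0 := by
  rw [species_eq_graphSum, FiberedBurnside.graphSum_cls]
  refine finsum_eq_zero_of_forall_eq_zero fun c => ?_
  refine Quotient.inductionOn c ?_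
  rintro ⟨b, q⟩
  obtain ⟨l, rfl⟩ := QuotientGroup.mk_surjective q
  obtain ⟨m, hm⟩ := not_forall.1 fun h => hM ((Subgroup.eq_top_iff' M).2 h)
  -- The stabilizer of `l M` is `l M l⁻¹`, which misses the conjugate of an element `m` outside `M`.
  refine graphSpecies_top_of_not ι (l := l * m * l⁻¹) (fun a ha => hm ?_) g
  have h1 := (mem_fiberGraph_cosetSet.1 ha).1
  change (l * m * l⁻¹) • (l : G ⧸ M) = (l : G ⧸ M) at h1
  rw [MulAction.Quotient.smul_coe, smul_eq_mul, inv_mul_cancel_right] at h1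
  rw [eq_comm, QuotientGroup.eq] at h1
  simpa using h1

/-- Normality of `M` makes `K` act trivially on `G/M`, so each of the cosets contributes `1`. -/
theorem species_cosetSet_of_le [Finite G] (ι : A →* kˣ) {K M : Subgroup G} [M.Normal]
    (hK : K ≤ M) (l : K) : species ι K l ((cosetSet A M).cls k) = (M.index : k) := by
  rw [species_eq_graphSum, FiberedBurnside.graphSum_cls]
  have := Fintype.ofFinite (G ⧸ M)
  have h1 : ∀ c, graphSpecies ι K (l : G) ((cosetSet A M).graphOf c) = 1 := by
    intro c
    refine Quotient.inductionOn c fun b => ?_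
    have hm : ∀ g ∈ K, (g, 1) ∈ (cosetSet A M).fiberGraph b := by
      intro g hg
      rw [mem_fiberGraph_cosetSet]
      refine ⟨?_, rfl⟩
      obtain ⟨b, q⟩ := b
      obtain ⟨r, rfl⟩ := QuotientGroup.mk_surjective q
      change g • (r : G ⧸ M) = (r : G ⧸ M)
      rw [MulAction.Quotient.smul_coe, smul_eq_mul, eq_comm, QuotientGroup.eq]
      have := ‹M.Normal›.conj_mem g (hK hg) r⁻¹
      simpa [mul_assoc] using this
    refine (graphSpecies_of_mem ι (fun a => FiberedSet.eq_one_of_mem_fiberGraph)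
      (fun g hg => ⟨1, hm g hg⟩) (hm l l.2)).trans (by simp)
  simp only [h1]
  let F : G ⧸ M → orbitRel.Quotient A (cosetSet A M) := fun q =>
    Quotient.mk (orbitRel A (cosetSet A M)) ((1, q) : A × (G ⧸ M))
  have hF : Function.Bijective F := by
    constructor
    · intro q r h
      obtain ⟨a, ha⟩ := Quotient.exact h
      exact (congrArg Prod.snd ha : r = q).symm
    · intro c
      refine Quotient.inductionOn c ?_
      rintro ⟨b, q⟩
      exact ⟨q, Quotient.sound ⟨b⁻¹, Prod.ext (inv_mul_cancel b) rfl⟩⟩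
  rw [← finsum_eq_of_bijective (f := fun _ => (1 : k)) F hF fun _ => rfl,
    finsum_eq_sum_of_fintype, Finset.sum_const, nsmul_eq_mul, mul_one, Finset.card_univ,
    Subgroup.index, Nat.card_eq_fintype_card]

end Characters

/-! ### The Frattini subgroup of a `p`-group, and the idempotents at `(G, g)`. -/

section Idempotents

variable {A G : Type u} [CommGroup A] [Group G]

/-- In a finite `p`-group, maximal subgroups are normal. -/
theorem IsPGroup.normal_of_isCoatom {p : ℕ} [Fact p.Prime] [Finite G] (hG : IsPGroup p G)
    {M : Subgroup G} (hM : IsCoatom M) : M.Normal := by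
  have := hG.isNilpotent
  exact Subgroup.NormalizerCondition.normal_of_coatom M Group.normalizerCondition_of_isNilpotent hM

/-- In a finite `p`-group, maximal subgroups have index `p`. -/
theorem IsPGroup.card_quotient_of_isCoatom {p : ℕ} [hp : Fact p.Prime] [Finite G]
    (hG : IsPGroup p G) {M : Subgroup G} [M.Normal] (hM : IsCoatom M) :
    Nat.card (G ⧸ M) = p := by
  have : Nontrivial (G ⧸ M) := QuotientGroup.nontrivial_iff.2 hM.1
  obtain ⟨n, hn, h⟩ := (IsPGroup.nontrivial_iff_card (hG.to_quotient M)).1 this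
  obtain ⟨z, hz⟩ := exists_prime_orderOf_dvd_card' (G := G ⧸ M) p (h ▸ dvd_pow_self p hn.ne')
  have htop : Subgroup.zpowers z = ⊤ := by
    have h1 : M ≤ (Subgroup.zpowers z).comap (QuotientGroup.mk' M) := by
      intro m hm
      rw [Subgroup.mem_comap, QuotientGroup.mk'_apply, (QuotientGroup.eq_one_iff m).2 hm]
      exact one_mem _
    have h2 : (Subgroup.zpowers z).comap (QuotientGroup.mk' M) = ⊤ := by
      refine hM.2 _ (lt_of_le_of_ne h1 fun h => ?_)
      obtain ⟨g, rfl⟩ := QuotientGroup.mk'_surjective M z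
      have hg : g ∈ M := h ▸ Subgroup.mem_zpowers _
      rw [QuotientGroup.mk'_apply, (QuotientGroup.eq_one_iff g).2 hg, orderOf_one] at hz
      exact hp.out.one_lt.ne hz
    rw [← Subgroup.comap_top (QuotientGroup.mk' M)] at h2
    exact Subgroup.comap_injective (QuotientGroup.mk'_surjective M) h2
  rw [← hz, ← Nat.card_zpowers, htop, Subgroup.card_top]

/-- The elements outside of the Frattini subgroup are detected by characters of order `p`. -/
theorem IsPGroup.exists_character {p : ℕ} [hp : Fact p.Prime] [Finite G] (hG : IsPGroup p G)
    [Finite A] (hA : p ∣ Nat.card A) {x : G} (hx : x ∉ frattini G) :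
    ∃ φ : G →* A, φ x ≠ 1 ∧ (∀ y, φ y ^ p = 1) ∧ frattini G ≤ φ.ker := by
  obtain ⟨M, hM, hxM⟩ : ∃ M : Subgroup G, IsCoatom M ∧ x ∉ M := by
    by_contra! h
    refine hx ?_
    simp only [frattini, Order.radical, Subgroup.mem_iInf]
    exact fun M hM => h M hM
  have := hG.normal_of_isCoatom hM
  obtain ⟨a, ha⟩ := exists_prime_orderOf_dvd_card' (G := A) p hA
  let e : G ⧸ M ≃* Subgroup.zpowers a := mulEquivOfPrimeCardEq
    (hG.card_quotient_of_isCoatom hM) (by rw [Nat.card_zpowers, ha])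
  refine ⟨(Subgroup.zpowers a).subtype.comp (e.toMonoidHom.comp (QuotientGroup.mk' M)), ?_, ?_, ?_⟩
  · intro h
    refine hxM ((QuotientGroup.eq_one_iff x).1 ?_)
    exact e.injective (Subtype.ext (h.trans (by simp)))
  · intro y
    rw [← map_pow, ← hG.card_quotient_of_isCoatom hM, MonoidHom.comp_apply,
      MonoidHom.comp_apply, map_pow (QuotientGroup.mk' M), pow_card_eq_one', map_one, map_one]
  · intro y hy
    have hy' : QuotientGroup.mk' M y = 1 :=
      (QuotientGroup.eq_one_iff y).2 (frattini_le_coatom hM hy)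
    rw [MonoidHom.mem_ker, MonoidHom.comp_apply, MonoidHom.comp_apply, hy', map_one, map_one]

theorem IsPGroup.homKernel_le_frattini {p : ℕ} [Fact p.Prime] [Finite G] (hG : IsPGroup p G)
    [Finite A] (hA : p ∣ Nat.card A) : homKernel A G ≤ frattini G := by
  intro x hx
  by_contra h
  obtain ⟨φ, hφ, -⟩ := hG.exists_character hA h
  exact hφ (mem_homKernel.1 hx φ)

/-- The characters detecting elements outside `Φ(G)` are trivial on `Φ(G)`, hence descend to the
quotient and separate its points. -/
theorem IsPGroup.homKernel_quotient_frattini {p : ℕ} [Fact p.Prime] [Finite G]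
    (hG : IsPGroup p G) [Finite A] (hA : p ∣ Nat.card A) :
    homKernel A (G ⧸ frattini G) = ⊥ := by
  refine (Subgroup.eq_bot_iff_forall _).2 fun q hq => ?_
  obtain ⟨x, rfl⟩ := QuotientGroup.mk_surjective q
  rw [QuotientGroup.eq_one_iff]
  by_contra h
  obtain ⟨φ, hφ, -, hle⟩ := hG.exists_character hA h
  exact hφ (mem_homKernel.1 hq (QuotientGroup.lift (frattini G) φ hle))

/-- When `Φ(G)` is trivial, characters of exponent `p` with values in the abelian group `A` detect
every nontrivial element; they kill commutators and `p`-th powers. -/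
theorem IsPGroup.isElementaryAbelian_of_frattini_eq_bot {p : ℕ} [Fact p.Prime] [Finite G]
    (hG : IsPGroup p G) (A : Type u) [CommGroup A] [Finite A] (hA : p ∣ Nat.card A)
    (h : frattini G = ⊥) : IsElementaryAbelian p G := by
  have key : ∀ z : G, (∀ φ : G →* A, (∀ y, φ y ^ p = 1) → φ z = 1) → z = 1 := by
    intro z hz
    by_contra hne
    obtain ⟨φ, hφ, hφp, -⟩ := hG.exists_character (A := A) hA (x := z)
      (by rwa [h, Subgroup.mem_bot])
    exact hφ (hz φ hφp)
  constructor
  · intro x y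
    refine inv_mul_eq_one.1 (key _ fun φ _ => ?_)
    simp only [map_mul, map_inv]
    rw [mul_comm (φ y), inv_mul_cancel]
  · intro x
    exact key _ fun φ hφ => by rw [map_pow, hφ]

variable {k : Type v} [Field k]

theorem IsPGroup.cast_card_ne_zero {p : ℕ} [Fact p.Prime] [Finite G] (hG : IsPGroup p G)
    (hk : (p : k) ≠ 0) : (Nat.card G : k) ≠ 0 := by
  obtain ⟨n, hn⟩ := IsPGroup.iff_card.1 hG
  rw [hn, Nat.cast_pow]
  exact pow_ne_zero n hk

/-- The pair `(G, g)` is separated from all other pairs. -/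
theorem exists_species_separating {p : ℕ} [Fact p.Prime] [Finite G] (hG : IsPGroup p G)
    (hk : (p : k) ≠ 0) (ι : A →* kˣ) (hι : Function.Injective ι) (g : G) (K : Subgroup G) (l : K)
    (h : ¬ (K = ⊤ ∧ (l : G)⁻¹ * g ∈ homKernel A G)) :
    ∃ x : FiberedBurnside k A G,
      species ι ⊤ ⟨g, Subgroup.mem_top g⟩ x = 1 ∧ species ι K l x = 0 := by
  rcases eq_top_or_exists_le_coatom K with rfl | ⟨M, hM, hKM⟩
  · have h' : ¬ (l : G)⁻¹ * g ∈ homKernel A G := fun h' => h ⟨rfl, h'⟩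
    rw [mem_homKernel] at h'
    push Not at h'
    obtain ⟨ν, hν⟩ := h'
    have hne : (ι (ν g) : k) - ι (ν l) ≠ 0 := by
      refine sub_ne_zero.2 fun h => hν ?_
      rw [map_mul, map_inv, hι (Units.ext h), inv_mul_cancel]
    -- For a character with `ν g ≠ ν l`, interpolate: `(ν - ν(l)) / (ν(g) - ν(l))`, where the
    -- constant stands for a multiple of the class of the trivial character.
    refine ⟨((ι (ν g) : k) - ι (ν l))⁻¹ • ((characterSet ν).cls k -
      (ι (ν l) : k) • (characterSet 1).cls k), ?_, ?_⟩
    · simp only [map_smul, map_sub, species_characterSet, smul_eq_mul]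
      simpa using inv_mul_cancel₀ hne
    · simp only [map_smul, map_sub, species_characterSet, smul_eq_mul]
      simp
  · have := hG.normal_of_isCoatom hM
    have hidx : (M.index : k) ≠ 0 := by
      obtain ⟨n, hn⟩ := hG.index M
      rw [hn, Nat.cast_pow]
      exact pow_ne_zero n hk
    -- The element `1 - [A × G/M] / |G : M|`, for a maximal subgroup `M` containing `K`.
    refine ⟨(characterSet 1).cls k - (M.index : k)⁻¹ • (cosetSet A M).cls k, ?_, ?_⟩
    · rw [map_sub, map_smul, species_characterSet, species_top_cosetSet ι hM.1]
      simp
    · rw [map_sub, map_smul, species_characterSet, species_cosetSet_of_le ι hKM]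
      simp [hidx]

/-- There are finitely many pairs `(K, l)`. By multiplicativity, the product of elements separating
`(G, g)` from each inequivalent pair has the required species. -/
theorem exists_species_eq [Finite A] {p : ℕ} [Fact p.Prime] [Finite G] (hG : IsPGroup p G)
    (hk : (p : k) ≠ 0) (ι : A →* kˣ) (hι : Function.Injective ι) (g : G) :
    ∃ x : FiberedBurnside k A G, species ι ⊤ ⟨g, Subgroup.mem_top g⟩ x = 1 ∧
      ∀ (K : Subgroup G) (l : K), ¬ (K = ⊤ ∧ (l : G)⁻¹ * g ∈ homKernel A G) →
        species ι K l x = 0 := by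
  classical
  have := Fintype.ofFinite (Σ K : Subgroup G, K)
  suffices h : ∀ S : Finset (Σ K : Subgroup G, K),
      ∃ x : FiberedBurnside k A G, species ι ⊤ ⟨g, Subgroup.mem_top g⟩ x = 1 ∧
        ∀ q ∈ S, ¬ (q.1 = ⊤ ∧ (q.2 : G)⁻¹ * g ∈ homKernel A G) → species ι q.1 q.2 x = 0 by
    obtain ⟨x, h1, h2⟩ := h Finset.univ
    exact ⟨x, h1, fun K l => h2 ⟨K, l⟩ (Finset.mem_univ _)⟩
  intro S
  induction S using Finset.induction_on with
  | empty =>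
    refine ⟨(characterSet 1).cls k, ?_, by simp⟩
    rw [species_characterSet]
    simp
  | insert q S _ ih =>
    obtain ⟨x, h1, h2⟩ := ih
    by_cases hq : q.1 = ⊤ ∧ (q.2 : G)⁻¹ * g ∈ homKernel A G
    · refine ⟨x, h1, fun r hr hr' => h2 r ?_ hr'⟩
      exact (Finset.mem_insert.1 hr).resolve_left fun h => hr' (h ▸ hq)
    · obtain ⟨y, h3, h4⟩ := exists_species_separating hG hk ι hι g q.1 q.2 hq
      refine ⟨FiberedBurnside.mul x y, by rw [species_mul, h1, h3, one_mul], fun r hr hr' => ?_⟩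
      rw [species_mul]
      rcases Finset.mem_insert.1 hr with rfl | hr
      · rw [h4, mul_zero]
      · rw [h2 r hr hr', zero_mul]

theorem FiberedBurnside.eq_of_species [Finite A] [Finite G] (hk : (Nat.card G : k) ≠ 0)
    (ι : A →* kˣ) (hι : Function.Injective ι) {x y : FiberedBurnside k A G}
    (hx : ∀ (V : Subgroup G) (v : V), species ι V v x = species ι V v y) : x = y :=
  sub_eq_zero.1 (FiberedBurnside.eq_zero_of_species hk ι hι _ fun V v => by
    rw [map_sub, hx, sub_self])

/-- The species values force idempotency and primitivity, because species are multiplicative and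
separate elements: below `e`, an idempotent is determined by its single species value at `(G, g)`.
-/
theorem isIdempotentAt_top_iff [Finite A] [Finite G] (hk : (Nat.card G : k) ≠ 0)
    (ι : A →* kˣ) (hι : Function.Injective ι) (g : G) (e : FiberedBurnside k A G) :
    IsIdempotentAt ι ⊤ ⟨g, Subgroup.mem_top g⟩ e ↔
      species ι ⊤ ⟨g, Subgroup.mem_top g⟩ e = 1 ∧
      ∀ (K : Subgroup G) (l : K), ¬ (K = ⊤ ∧ (l : G)⁻¹ * g ∈ homKernel A G) →
        species ι K l e = 0 := by
  classical
  constructor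
  · intro h
    refine ⟨?_, fun K l hKl => ?_⟩
    · rw [h.species_eq, if_pos ⟨1, pairConjBy_top_iff.2 ⟨rfl, by simp⟩⟩]
    · rw [h.species_eq, if_neg]
      rintro ⟨x, hx⟩
      exact hKl (pairConjBy_top_iff.1 hx)
  · rintro ⟨h1, h2⟩
    have h3 : ∀ (K : Subgroup G) (l : K), (K = ⊤ ∧ (l : G)⁻¹ * g ∈ homKernel A G) →
        ∀ x : FiberedBurnside k A G,
          species ι K l x = species ι ⊤ ⟨g, Subgroup.mem_top g⟩ x := by
      rintro K l ⟨rfl, hl⟩ x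
      exact species_top_congr ι hl x
    refine ⟨⟨?_, ?_, ?_⟩, fun K l => ?_⟩
    · rintro rfl
      rw [map_zero] at h1
      exact zero_ne_one h1
    · refine FiberedBurnside.eq_of_species hk ι hι fun K l => ?_
      rw [species_mul]
      by_cases hKl : K = ⊤ ∧ (l : G)⁻¹ * g ∈ homKernel A G
      · rw [h3 K l hKl, h1, one_mul]
      · rw [h2 K l hKl, zero_mul]
    · intro f hf hef
      -- This value is an idempotent of the field `k`.
      have h4 : species ι ⊤ ⟨g, Subgroup.mem_top g⟩ f = 0 ∨
          species ι ⊤ ⟨g, Subgroup.mem_top g⟩ f = 1 := by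
        refine IsIdempotentElem.iff_eq_zero_or_one.1 ?_
        rw [IsIdempotentElem, ← species_mul, hf]
      have h5 : ∀ (K : Subgroup G) (l : K), ¬ (K = ⊤ ∧ (l : G)⁻¹ * g ∈ homKernel A G) →
          species ι K l f = 0 := fun K l hKl => by
        rw [← hef, species_mul, h2 K l hKl, zero_mul]
      refine h4.imp (fun h4 => ?_) fun h4 => ?_ <;>
        refine FiberedBurnside.eq_of_species hk ι hι fun K l => ?_ <;>
        by_cases hKl : K = ⊤ ∧ (l : G)⁻¹ * g ∈ homKernel A G
      · rw [h3 K l hKl, h4, map_zero]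
      · rw [h5 K l hKl, map_zero]
      · rw [h3 K l hKl, h3 K l hKl, h4, h1]
      · rw [h5 K l hKl, h2 K l hKl]
    · split_ifs with h
      · obtain ⟨x, hx⟩ := h
        rw [h3 K l (pairConjBy_top_iff.1 hx), h1]
      · exact h2 K l fun hKl => h ⟨1, pairConjBy_top_iff.2 hKl⟩

theorem existsUnique_isIdempotentAt_top [Finite A] {p : ℕ} [Fact p.Prime] [Finite G]
    (hG : IsPGroup p G) (hk : (p : k) ≠ 0) (ι : A →* kˣ) (hι : Function.Injective ι) (g : G) :
    ∃! e : FiberedBurnside k A G, IsIdempotentAt ι ⊤ ⟨g, Subgroup.mem_top g⟩ e := by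
  have hk' := hG.cast_card_ne_zero hk
  obtain ⟨e, he⟩ := exists_species_eq hG hk ι hι g
  refine ⟨e, (isIdempotentAt_top_iff hk' ι hι g e).2 he, fun f hf => ?_⟩
  refine FiberedBurnside.eq_of_species hk' ι hι fun K l => ?_
  rw [hf.species_eq, ((isIdempotentAt_top_iff hk' ι hι g e).2 he).species_eq]

end Idempotents

/-! ### Graphs and species of a deflation. -/

section Deflation

variable {A G : Type u} [CommGroup A] [Group G] {k : Type v} [Field k]

/-- The projection `G × A → G/N × A`. -/
def quotientProd (A : Type u) [CommGroup A] (N : Subgroup G) [N.Normal] : G × A →* (G ⧸ N) × A :=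
  (QuotientGroup.mk' N).prodMap (MonoidHom.id A)

theorem mem_map_quotientProd {N : Subgroup G} [N.Normal] {D : Subgroup (G × A)} {g : G} {a : A} :
    ((g : G ⧸ N), a) ∈ D.map (quotientProd A N) ↔ ∃ n ∈ N, (n * g, a) ∈ D := by
  constructor
  · rintro ⟨⟨h, b⟩, hD, h'⟩
    obtain ⟨h1, h2⟩ := Prod.ext_iff.1 h'
    change ((h : G ⧸ N)) = g at h1
    change b = a at h2
    subst h2
    refine ⟨h * g⁻¹, ?_, by rwa [inv_mul_cancel_right]⟩
    rw [← QuotientGroup.eq_one_iff, QuotientGroup.mk_mul, h1, QuotientGroup.mk_inv,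
      mul_inv_cancel]
  · rintro ⟨n, hn, hD⟩
    refine ⟨_, hD, Prod.ext ?_ rfl⟩
    change ((n * g : G) : G ⧸ N) = g
    rw [QuotientGroup.mk_mul, (QuotientGroup.eq_one_iff n).2 hn, one_mul]

/-- The inverse of the number of fibers in the `N`-orbit of a fiber. -/
noncomputable def stabilizerRatio (k : Type v) [Field k] (N : Subgroup G)
    (D : Subgroup (G × A)) : k :=
  (Nat.card (N ⊓ D.map (MonoidHom.fst G A) : Subgroup G) : k) / (Nat.card N : k)

/-- When `Z` is the quotient of `X` by `N`, its fibers are the `N`-orbits of fibers of `X`.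
Weighting each fiber of `X` by the inverse of the length of its orbit counts each fiber of `Z` once.
-/
theorem FiberedSet.graphSum_of_quotient [Finite G] (N : Subgroup G) [N.Normal]
    (hN : (Nat.card N : k) ≠ 0) (X : FiberedSet A G) (Z : FiberedSet A (G ⧸ N)) (π : X → Z)
    (hπ : Function.Surjective π) (hA : ∀ (a : A) x, π (a • x) = a • π x)
    (hG : ∀ (g : G) x, π (g • x) = (g : G ⧸ N) • π x)
    (hπN : ∀ x y, π x = π y ↔ ∃ n ∈ N, n • x = y) (f : Subgroup ((G ⧸ N) × A) → k) :
    ∑ᶠ d, f (Z.graphOf d) =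
      ∑ᶠ c, stabilizerRatio k N (X.graphOf c) * f ((X.graphOf c).map (quotientProd A N)) := by
  classical
  have := Fintype.ofFinite (orbitRel.Quotient A X)
  have := Fintype.ofFinite (orbitRel.Quotient A Z)
  have hgraph : ∀ x, (X.fiberGraph x).map (quotientProd A N) = Z.fiberGraph (π x) := by
    intro x
    refine Subgroup.ext ?_
    rintro ⟨q, a⟩
    obtain ⟨g, rfl⟩ := QuotientGroup.mk_surjective q
    rw [mem_map_quotientProd, FiberedSet.mem_fiberGraph, ← hA, ← hG, hπN]
    simp only [FiberedSet.mem_fiberGraph, mul_smul]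
  let Q : orbitRel.Quotient A X → orbitRel.Quotient A Z := Quotient.map π (by
    rintro _ x ⟨a, rfl⟩
    exact ⟨a, (hA a x).symm⟩)
  rw [finsum_eq_sum_of_fintype, finsum_eq_sum_of_fintype, ← Finset.sum_fiberwise _ Q]
  refine Finset.sum_congr rfl fun d _ => ?_
  refine Quotient.inductionOn d fun z => ?_
  obtain ⟨x, rfl⟩ := hπ z
  have h1 : ∀ c ∈ Finset.univ.filter (fun c => Q c = Quotient.mk _ (π x)),
      stabilizerRatio k N (X.graphOf c) * f ((X.graphOf c).map (quotientProd A N)) =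
        stabilizerRatio k N (X.graphOf c) * f (Z.graphOf (Quotient.mk _ (π x))) := by
    intro c hc
    rw [← (Finset.mem_filter.1 hc).2]
    congr 2
    exact Quotient.inductionOn c fun y => hgraph y
  have h2 : ∀ c, Q c = Quotient.mk _ (π x) ↔
      ∃ n ∈ N, Quotient.mk (orbitRel A X) (n • x) = c := by
    refine fun c => Quotient.inductionOn c fun y => ?_
    change Quotient.mk (orbitRel A Z) (π y) = _ ↔ _
    rw [FiberedSet.fiber_eq_iff]
    simp only [FiberedSet.fiber_eq_iff]
    constructor
    · rintro ⟨a, h⟩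
      rw [← hA, eq_comm, hπN] at h
      obtain ⟨n, hn, h⟩ := h
      refine ⟨n, hn, a⁻¹, ?_⟩
      rw [← h, ← smul_comm a n, inv_smul_smul]
    · rintro ⟨n, hn, a, h⟩
      refine ⟨a⁻¹, ?_⟩
      rw [← hA, eq_comm, hπN]
      exact ⟨n, hn, by rw [← smul_comm a⁻¹ n, h, inv_smul_smul]⟩
  rw [Finset.sum_congr rfl h1, ← Finset.sum_mul]
  simp only [stabilizerRatio, h2]
  rw [← Finset.sum_div, Finset.sum_filter, ← X.sum_card_stabilizer N x]
  rw [← X.sum_card_stabilizer N x] at hN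
  push_cast at hN ⊢
  rw [div_self hN, one_mul]

open Classical in
/-- The weight of a fiber of `X` in the sum over the fibers of `Def X`. -/
noncomputable def deflationWeight (N : Subgroup G) [N.Normal]
    (f : Subgroup ((G ⧸ N) × A) → k) (D : Subgroup (G × A)) : k :=
  if ∀ n ∈ N, ∀ a, (n, a) ∈ D → a = 1 then
    stabilizerRatio k N D * f (D.map (quotientProd A N)) else 0

/-- The orbit of `(1, x)` in the deflation. -/
def deflationMk [Finite G] (N : Subgroup G) [N.Normal] (X : FiberedSet A G) (x : X) :
    FiberedBiset.Amalg (deflationBiset A N) X :=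
  FiberedBiset.mk (deflationBiset A N) X ((1, 1) : A × (G ⧸ N)) x

theorem mk_eq_deflationMk [Finite G] {N : Subgroup G} [N.Normal] {X : FiberedSet A G}
    (a : A) (g : G) (x : X) :
    FiberedBiset.mk (deflationBiset A N) X ((a, (g : G ⧸ N)) : A × (G ⧸ N)) x =
      deflationMk N X (a • g • x) := by
  refine FiberedBiset.mk_eq.2 ⟨a, g, ?_, rfl⟩
  refine Prod.ext (inv_mul_cancel a).symm ?_
  change 1 = 1 * (g : G ⧸ N) * (g : G ⧸ N)⁻¹
  simp

theorem deflationMk_smulA [Finite G] {N : Subgroup G} [N.Normal] {X : FiberedSet A G}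
    (a : A) (x : X) : deflationMk N X (a • x) = a • deflationMk N X x := by
  have := mk_eq_deflationMk (N := N) a 1 x
  rw [one_smul] at this
  rw [← this]
  change _ = FiberedBiset.mk (deflationBiset A N) X ((a * 1, 1) : A × (G ⧸ N)) x
  rw [mul_one, QuotientGroup.mk_one]

theorem deflationMk_smulG [Finite G] {N : Subgroup G} [N.Normal] {X : FiberedSet A G}
    (g : G) (x : X) : deflationMk N X (g • x) = (g : G ⧸ N) • deflationMk N X x := by
  have := mk_eq_deflationMk (N := N) 1 g x
  rw [one_smul] at this
  rw [← this]
  change _ = FiberedBiset.mk (deflationBiset A N) X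
    ((1, (g : G ⧸ N) * 1 * ((1 : G) : G ⧸ N)⁻¹) : A × (G ⧸ N)) x
  rw [QuotientGroup.mk_one, inv_one, mul_one, mul_one]

theorem deflationMk_eq_iff [Finite G] {N : Subgroup G} [N.Normal] {X : FiberedSet A G}
    {x y : X} : deflationMk N X x = deflationMk N X y ↔ ∃ n ∈ N, n • x = y := by
  refine FiberedBiset.mk_eq.trans ?_
  constructor
  · rintro ⟨a, g, h1, rfl⟩
    obtain ⟨h2, h3⟩ := Prod.ext_iff.1 h1
    change 1 = a⁻¹ * 1 at h2
    change 1 = 1 * 1 * (g : G ⧸ N)⁻¹ at h3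
    obtain rfl : a = 1 := by simpa using h2.symm
    refine ⟨g, ?_, by simp⟩
    rw [← QuotientGroup.eq_one_iff]
    simpa using h3.symm
  · rintro ⟨n, hn, rfl⟩
    refine ⟨1, n, ?_, by simp⟩
    refine Prod.ext ?_ ?_
    · change 1 = (1 : A)⁻¹ * 1
      simp
    · change 1 = 1 * 1 * (n : G ⧸ N)⁻¹
      rw [(QuotientGroup.eq_one_iff n).2 hn]
      simp

theorem deflationMk_surjective [Finite G] {N : Subgroup G} [N.Normal] {X : FiberedSet A G} :
    Function.Surjective (deflationMk N X) := by
  intro c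
  obtain ⟨⟨a, q⟩, x, rfl⟩ := FiberedBiset.mk_surj c
  obtain ⟨g, rfl⟩ := QuotientGroup.mk_surjective q
  exact ⟨a • g • x, (mk_eq_deflationMk a g x).symm⟩

/-- `a` fixes the `N`-orbit of `x` exactly when some `n ∈ N` acts on `x` as `a`. Freeness thus means
that the partial homomorphism of `x` is trivial where it is defined on `N`. -/
theorem deflationMk_free_iff [Finite G] {N : Subgroup G} [N.Normal] {X : FiberedSet A G} {x : X} :
    (∀ a : A, a • deflationMk N X x = deflationMk N X x → a = 1) ↔
      ∀ n ∈ N, ∀ a, (n, a) ∈ X.fiberGraph x → a = 1 := by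
  have : ∀ a : A, a • deflationMk N X x = deflationMk N X x ↔
      ∃ n ∈ N, (n, a) ∈ X.fiberGraph x := by
    intro a
    rw [← deflationMk_smulA, eq_comm, deflationMk_eq_iff]
    rfl
  simp only [this]
  exact ⟨fun h n hn a ha => h a ⟨n, hn, ha⟩, fun h a ⟨n, hn, ha⟩ => h n hn a ha⟩

/-- Sums over the fibers of a deflation. -/
theorem FiberedBurnside.graphSum_deflation [Finite G] (N : Subgroup G) [N.Normal]
    (hN : (Nat.card N : k) ≠ 0) (f : Subgroup ((G ⧸ N) × A) → k) (x : FiberedBurnside k A G) :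
    FiberedBurnside.graphSum f (deflation k A N x) =
      FiberedBurnside.graphSum (deflationWeight N f) x := by
  refine LinearMap.congr_fun (f := (FiberedBurnside.graphSum f).comp (deflation k A N))
    (FiberedBurnside.hom_ext fun X => ?_) x
  rw [LinearMap.comp_apply, deflation, FiberedBiset.map, FiberedBurnside.lift_cls,
    FiberedBurnside.graphSum_cls]
  -- The points of `X` whose image in the deflation has a free `A`-orbit.
  let P : X → Prop := fun x => ∀ n ∈ N, ∀ a, (n, a) ∈ X.fiberGraph x → a = 1
  have hA : ∀ (a : A) x, P (a • x) ↔ P x := fun a x => by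
    simp only [P, X.fiberGraph_smul]
  have hG : ∀ (g : G) x, P (g • x) ↔ P x := fun g x => by
    have h1 : ∀ a : A, a • deflationMk N X (g • x) = deflationMk N X (g • x) ↔
        a • deflationMk N X x = deflationMk N X x := fun a => by
      rw [deflationMk_smulG, smul_comm]
      exact (MulAction.injective (g : G ⧸ N)).eq_iff
    simp only [P, ← deflationMk_free_iff, h1]
  have hsum := FiberedSet.cls_eq_of_iso k (X.restrict_sum_iso P hA hG)
  rw [← hsum, FiberedSet.cls_sum, map_add, FiberedBurnside.graphSum_cls,
    FiberedBurnside.graphSum_cls]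
  -- The other points are discarded by the tensor product and have weight `0`.
  rw [finsum_eq_zero_of_forall_eq_zero (f := fun c => deflationWeight N f
    ((X.restrict (fun x => ¬ P x) (fun a x => not_congr (hA a x))
      fun g x => not_congr (hG g x)).graphOf c)), add_zero]
  · let π : X.restrict P hA hG → FiberedBiset.tensor (deflationBiset A N) X :=
      fun y => ⟨deflationMk N X y.1, deflationMk_free_iff.2 y.2⟩
    rw [FiberedSet.graphSum_of_quotient N hN (X.restrict P hA hG)
      (FiberedBiset.tensor (deflationBiset A N) X) π]
    · refine finsum_congr fun c => ?_
      refine Quotient.inductionOn c fun y => ?_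
      refine (if_pos ?_).symm
      rw [FiberedSet.graphOf_mk, FiberedSet.fiberGraph_restrict]
      exact y.2
    · rintro ⟨c, hc⟩
      obtain ⟨y, rfl⟩ := deflationMk_surjective c
      exact ⟨⟨y, deflationMk_free_iff.1 hc⟩, rfl⟩
    · exact fun a y => Subtype.ext (deflationMk_smulA a y.1)
    · exact fun g y => Subtype.ext (deflationMk_smulG g y.1)
    · intro y z
      refine Subtype.ext_iff.trans (deflationMk_eq_iff.trans ?_)
      exact exists_congr fun n => and_congr_right fun _ =>
        ⟨fun h => Subtype.ext h, fun h => congrArg Subtype.val h⟩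
  · intro c
    refine Quotient.inductionOn c fun y => ?_
    refine if_neg ?_
    rw [FiberedSet.graphOf_mk, FiberedSet.fiberGraph_restrict]
    exact y.2

/-- If the species at the pairs `(V, v)` with `V ≤ K` vanish, those of the deflation at the pairs
`(K/N, l)` vanish. -/
theorem species_deflation_eq_zero [Finite A] [Finite G] (ι : A →* kˣ)
    (hι : Function.Injective ι) (N : Subgroup G) [N.Normal] (hN : (Nat.card N : k) ≠ 0)
    (K : Subgroup (G ⧸ N)) (l : K) (x : FiberedBurnside k A G)
    (hx : ∀ V ≤ K.comap (QuotientGroup.mk' N), ∀ v : V, species ι V v x = 0) :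
    species ι K l (deflation k A N x) = 0 := by
  rw [species_eq_graphSum, FiberedBurnside.graphSum_deflation N hN]
  -- It remains to see that the weight of a graph depends only on its restriction to the preimage of
  -- `K`, which contains `N`.
  refine graphSum_eq_zero ι hι _ x hx _ fun D => ?_
  have hNK : N ≤ K.comap (QuotientGroup.mk' N) := fun n hn => by
    rw [Subgroup.mem_comap, QuotientGroup.mk'_apply, (QuotientGroup.eq_one_iff n).2 hn]
    exact one_mem K
  have hmem : ∀ g ∈ K.comap (QuotientGroup.mk' N), ∀ a : A,
      (g, a) ∈ D ↔ (g, a) ∈ D ⊓ (K.comap (QuotientGroup.mk' N)).prod ⊤ :=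
    fun g hg a => ⟨fun h => ⟨h, hg, trivial⟩, fun h => h.1⟩
  have h1 : (∀ n ∈ N, ∀ a, (n, a) ∈ D → a = 1) ↔
      ∀ n ∈ N, ∀ a, (n, a) ∈ D ⊓ (K.comap (QuotientGroup.mk' N)).prod ⊤ → a = 1 :=
    forall₂_congr fun n hn => forall_congr' fun a => by rw [hmem n (hNK hn)]
  have h2 : N ⊓ D.map (MonoidHom.fst G A) =
      N ⊓ (D ⊓ (K.comap (QuotientGroup.mk' N)).prod ⊤).map (MonoidHom.fst G A) := by
    ext n
    constructor
    · rintro ⟨hn, ⟨g, a⟩, h, rfl⟩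
      exact ⟨hn, (g, a), (hmem g (hNK hn) a).1 h, rfl⟩
    · rintro ⟨hn, ⟨g, a⟩, h, rfl⟩
      exact ⟨hn, (g, a), h.1, rfl⟩
  have h3 : ∀ q ∈ K, ∀ a : A, (q, a) ∈ D.map (quotientProd A N) ↔
      (q, a) ∈ (D ⊓ (K.comap (QuotientGroup.mk' N)).prod ⊤).map (quotientProd A N) := by
    intro q hq a
    obtain ⟨g, rfl⟩ := QuotientGroup.mk_surjective q
    rw [mem_map_quotientProd, mem_map_quotientProd]
    refine exists_congr fun n => and_congr_right fun hn => hmem _ ?_ _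
    exact mul_mem (hNK hn) hq
  have h4 : graphSpecies ι K (l : G ⧸ N) (D.map (quotientProd A N)) =
      graphSpecies ι K (l : G ⧸ N)
        ((D ⊓ (K.comap (QuotientGroup.mk' N)).prod ⊤).map (quotientProd A N)) :=
    graphSpecies_congr ι (forall₂_congr fun q hq => exists_congr fun a => h3 q hq a)
      fun a => h3 l l.2 a
  unfold deflationWeight stabilizerRatio
  rw [h2, h4]
  congr 1
  exact propext h1

theorem sum_character_subgroup [Finite G] (ι : A →* kˣ) (hι : Function.Injective ι) (φ : G →* A)
    (N : Subgroup G) [Fintype N] (hφ : ¬ N ≤ φ.ker) : ∑ n : N, (ι (φ n) : k) = 0 := by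
  refine sum_hom_units_eq_zero ((Units.coeHom k).comp (ι.comp (φ.comp N.subtype))) fun h => hφ ?_
  intro n hn
  have h1 := DFunLike.congr_fun h ⟨n, hn⟩
  exact hι ((Units.ext h1).trans (map_one ι).symm)

theorem FiberedBurnside.graphSum_mul_sum {τ : Type*} [Fintype τ] (c : k)
    (F : τ → Subgroup (G × A) → k) (x : FiberedBurnside k A G) :
    FiberedBurnside.graphSum (fun D => c * ∑ i, F i D) x =
      c * ∑ i, FiberedBurnside.graphSum (F i) x := by
  have h : FiberedBurnside.graphSum (fun D => c * ∑ i, F i D) =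
      c • ∑ i, (FiberedBurnside.graphSum (F i) : FiberedBurnside k A G →ₗ[k] k) := by
    refine FiberedBurnside.hom_ext fun X => ?_
    have := Fintype.ofFinite (orbitRel.Quotient A X)
    simp only [LinearMap.smul_apply, LinearMap.sum_apply, FiberedBurnside.graphSum_cls,
      finsum_eq_sum_of_fintype, smul_eq_mul]
    rw [← Finset.mul_sum, Finset.sum_comm]
  rw [h, LinearMap.smul_apply, LinearMap.sum_apply, smul_eq_mul]

/-- If `N` is contained in the Frattini subgroup, the species of the deflation at the pairs
`(G/N, l)` are averages. -/
theorem species_top_deflation [Finite G] (ι : A →* kˣ) (hι : Function.Injective ι)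
    (N : Subgroup G) [N.Normal] (hN : N ≤ frattini G) (hk : (Nat.card N : k) ≠ 0) [Fintype N]
    (l : G) (x : FiberedBurnside k A G) :
    species ι ⊤ ⟨(l : G ⧸ N), Subgroup.mem_top _⟩ (deflation k A N x) =
      (Nat.card N : k)⁻¹ * ∑ f : N, species ι ⊤ ⟨l * f, Subgroup.mem_top _⟩ x := by
  rw [species_eq_graphSum, FiberedBurnside.graphSum_deflation N hk]
  simp only [species_eq_graphSum]
  rw [← FiberedBurnside.graphSum_mul_sum]
  refine FiberedBurnside.graphSum_congr (fun D hD => ?_) x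
  obtain ⟨φ, hφ⟩ | ⟨m, hm⟩ := Subgroup.graph_cases hD
  · simp only [graphSpecies_top_of_hom ι hφ, map_mul, Units.val_mul]
    rw [← Finset.mul_sum]
    -- A fiber on which `G` acts through `φ` survives exactly when `φ` is trivial on `N`. Then `φ`
    -- descends to `G/N` and is constant on `l N`, so it equals its mean there.
    by_cases hφN : N ≤ φ.ker
    · have h1 : ∀ f : N, φ f = 1 := fun f => hφN f.2
      have hle : D.map (MonoidHom.fst G A) = ⊤ :=
        top_unique fun g _ => ⟨(g, φ g), (hφ _ _).2 rfl, rfl⟩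
      rw [deflationWeight, if_pos, stabilizerRatio, hle, inf_top_eq, div_self hk, one_mul,
        graphSpecies_top_of_hom ι (φ := QuotientGroup.lift N φ hφN)]
      · simp only [h1, map_one, Units.val_one, Finset.sum_const, Finset.card_univ, nsmul_eq_mul,
          mul_one, ← Nat.card_eq_fintype_card]
        rw [mul_comm (ι (φ l) : k), inv_mul_cancel_left₀ hk]
        rfl
      · intro q a
        obtain ⟨g, rfl⟩ := QuotientGroup.mk_surjective q
        rw [mem_map_quotientProd]
        simp only [hφ, map_mul]
        constructor
        · rintro ⟨n, hn, h⟩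
          rw [← h, MonoidHom.mem_ker.1 (hφN hn), one_mul]
          rfl
        · intro h
          exact ⟨1, one_mem N, by rw [map_one, one_mul]; exact h⟩
      · intro n hn a ha
        rw [← (hφ _ _).1 ha]
        exact hφN hn
    -- A character nontrivial on `N` has sum zero over `N`, and its fiber is discarded by the
    -- deflation.
    · rw [sum_character_subgroup ι hι φ N hφN, mul_zero, mul_zero, deflationWeight, if_neg]
      intro h
      exact hφN fun n hn => h n hn _ ((hφ _ _).2 rfl)
  -- Frattini argument: a proper stabilizer together with `N ≤ Φ(G)` still generates a proper
  -- subgroup, so its image does not stabilize a fiber over all of `G/N`.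
  · have hlt : D.map (MonoidHom.fst G A) ⊔ N ≠ ⊤ := by
      intro h
      have := frattini_nongenerating (top_unique (h.ge.trans (sup_le_sup_left hN _)))
      obtain ⟨⟨g, a⟩, hD, rfl⟩ := (this ▸ Subgroup.mem_top m : m ∈ D.map (MonoidHom.fst G A))
      exact hm a hD
    simp only [graphSpecies_top_of_not ι hm, Finset.sum_const_zero, mul_zero]
    obtain ⟨g, hg⟩ := not_forall.1 fun h => hlt ((Subgroup.eq_top_iff' _).2 h)
    unfold deflationWeight
    rw [graphSpecies_top_of_not ι (l := (g : G ⧸ N)), mul_zero, ite_self]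
    intro a ha
    obtain ⟨n, hn, h⟩ := mem_map_quotientProd.1 ha
    refine hg ?_
    rw [← inv_mul_cancel_left n g]
    exact mul_mem (Subgroup.mem_sup_right (inv_mem hn)) (Subgroup.mem_sup_left ⟨_, h, rfl⟩)

end Deflation

/-! ### Restrictions and twists by characters, as actions of bisets. -/

section Twist

variable {A G K : Type u} [CommGroup A] [Group G] [Group K] {k : Type v} [Field k]

/-- The underlying set of the biset of a twisted restriction. -/
def TwistCarrier (A G : Type u) : Type u := A × G

instance TwistCarrier.actA : MulAction A (TwistCarrier A G) where
  smul a c := (a * c.1, c.2)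
  one_smul c := Prod.ext (one_mul c.1) rfl
  mul_smul a b c := Prod.ext (mul_assoc a b c.1) rfl

/-- The `A`-fibered `(K, G)`-biset `A × G` on which `K` acts through `ν : K → A` and
`θ : K → G`. -/
def twistBiset [Finite G] (θ : K →* G) (ν : K →* A) : FiberedBiset A K G where
  carrier := TwistCarrier A G
  actG :=
    { smul := fun q c => (ν q.1 * c.1, θ q.1 * c.2 * q.2⁻¹)
      one_smul := fun c => Prod.ext
        (show ν 1 * c.1 = c.1 by simp) (show θ 1 * c.2 * 1⁻¹ = c.2 by simp)
      mul_smul := fun q r c => Prod.ext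
        (show ν (q.1 * r.1) * c.1 = ν q.1 * (ν r.1 * c.1) by simp [mul_assoc])
        (show θ (q.1 * r.1) * c.2 * (q.2 * r.2)⁻¹ = θ q.1 * (θ r.1 * c.2 * r.2⁻¹) * q.2⁻¹ by
          simp [mul_assoc]) }
  comm := by
    let : SMul (K × G) (TwistCarrier A G) :=
      ⟨fun q c => (ν q.1 * c.1, θ q.1 * c.2 * q.2⁻¹)⟩
    exact ⟨fun a q c => Prod.ext (mul_left_comm a (ν q.1) c.1) rfl⟩
  free a c h := mul_eq_right.1 (congrArg Prod.fst h : a * c.1 = c.1)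
  finite_fibers := by
    refine Finite.of_surjective
      (fun c : G => Quotient.mk (orbitRel A (TwistCarrier A G)) ((1, c) : A × G)) fun c => ?_
    refine Quotient.inductionOn c ?_
    rintro ⟨a, c⟩
    exact ⟨c, Quotient.sound ⟨a⁻¹, Prod.ext (inv_mul_cancel a) rfl⟩⟩

/-- The orbit of `(1, x)` in the twisted restriction. -/
def twistMk [Finite G] (θ : K →* G) (ν : K →* A) (X : FiberedSet A G) (x : X) :
    FiberedBiset.Amalg (twistBiset θ ν) X :=
  FiberedBiset.mk (twistBiset θ ν) X ((1, 1) : A × G) x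

theorem mk_eq_twistMk [Finite G] {θ : K →* G} {ν : K →* A} {X : FiberedSet A G}
    (a : A) (g : G) (x : X) :
    FiberedBiset.mk (twistBiset θ ν) X ((a, g) : A × G) x = twistMk θ ν X (a • g • x) := by
  refine FiberedBiset.mk_eq.2 ⟨a, g, ?_, rfl⟩
  refine Prod.ext ?_ ?_
  · change 1 = a⁻¹ * (ν 1 * a)
    simp
  · change 1 = θ 1 * g * g⁻¹
    simp

theorem twistMk_smulA [Finite G] {θ : K →* G} {ν : K →* A} {X : FiberedSet A G}
    (a : A) (x : X) : twistMk θ ν X (a • x) = a • twistMk θ ν X x := by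
  have := mk_eq_twistMk (θ := θ) (ν := ν) a 1 x
  rw [one_smul] at this
  rw [← this]
  change _ = FiberedBiset.mk (twistBiset θ ν) X ((a * 1, 1) : A × G) x
  rw [mul_one]

theorem smul_twistMk [Finite G] {θ : K →* G} {ν : K →* A} {X : FiberedSet A G}
    (h : K) (x : X) : h • twistMk θ ν X x = twistMk θ ν X (ν h • θ h • x) := by
  rw [← mk_eq_twistMk]
  change FiberedBiset.mk (twistBiset θ ν) X ((ν h * 1, θ h * 1 * 1⁻¹) : A × G) x = _
  simp

/-- Every `A × G`-orbit has a unique representative with first component `(1, 1)`. Hence the amalgam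
is `X` itself, with `h` acting as `ν h • θ h`, and no fiber is lost for want of freeness. -/
theorem twistMk_injective [Finite G] {θ : K →* G} {ν : K →* A} {X : FiberedSet A G} :
    Function.Injective (twistMk θ ν X) := by
  intro x y h
  obtain ⟨a, g, h1, rfl⟩ := FiberedBiset.mk_eq.1 h
  obtain ⟨h2, h3⟩ := Prod.ext_iff.1 h1
  change 1 = a⁻¹ * (ν 1 * 1) at h2
  change 1 = θ 1 * 1 * g⁻¹ at h3
  obtain rfl : a = 1 := by simpa using h2.symm
  obtain rfl : g = 1 := by simpa using h3.symm
  simp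

theorem twistMk_surjective [Finite G] {θ : K →* G} {ν : K →* A} {X : FiberedSet A G} :
    Function.Surjective (twistMk θ ν X) := by
  intro c
  obtain ⟨⟨a, g⟩, x, rfl⟩ := FiberedBiset.mk_surj c
  exact ⟨a • g • x, (mk_eq_twistMk a g x).symm⟩

/-- The species of a twisted restriction. -/
theorem species_top_twist [Finite G] (ι : A →* kˣ) (θ : K →* G) (ν : K →* A) {H : Subgroup G}
    (hH : θ.range = H) (h : K) (l : H) (hl : θ h = l) (x : FiberedBurnside k A G) :
    species ι ⊤ ⟨h, Subgroup.mem_top h⟩ (FiberedBiset.map k (twistBiset θ ν) x) =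
      ι (ν h) * species ι H l x := by
  refine LinearMap.congr_fun
    (f := (species ι ⊤ ⟨h, Subgroup.mem_top h⟩).comp (FiberedBiset.map k (twistBiset θ ν)))
    (g := (ι (ν h) : k) • species ι H l) (FiberedBurnside.hom_ext fun X => ?_) x
  rw [LinearMap.comp_apply, LinearMap.smul_apply, FiberedBiset.map, FiberedBurnside.lift_cls,
    species_eq_graphSum, species_eq_graphSum, FiberedBurnside.graphSum_cls,
    FiberedBurnside.graphSum_cls, smul_eq_mul]
  let τ : X → FiberedBiset.tensor (twistBiset θ ν) X := fun y => ⟨twistMk θ ν X y, fun a ha => by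
    rw [← twistMk_smulA] at ha
    exact X.free a y (twistMk_injective ha)⟩
  have hτ : Function.Bijective τ := by
    refine ⟨fun y z hyz => twistMk_injective (congrArg Subtype.val hyz), fun c => ?_⟩
    obtain ⟨y, hy⟩ := twistMk_surjective c.1
    exact ⟨y, Subtype.ext hy⟩
  have hτA : ∀ (a : A) y, τ (a • y) = a • τ y := fun a y => Subtype.ext (twistMk_smulA a y)
  have hτK : ∀ (g : K) y, g • τ y = τ (ν g • θ g • y) := fun g y =>
    Subtype.ext (smul_twistMk g y)
  -- The partial homomorphism of the twisted set is `ν` times the pullback along `θ` of the original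
  -- one.
  have hmem : ∀ (y : X) (g : K) (a : A),
      (g, a) ∈ (FiberedBiset.tensor (twistBiset θ ν) X).fiberGraph (τ y) ↔
        (θ g, (ν g)⁻¹ * a) ∈ X.fiberGraph y := by
    intro y g a
    rw [FiberedSet.mem_fiberGraph, FiberedSet.mem_fiberGraph, hτK, ← hτA, hτ.1.eq_iff, mul_smul,
      eq_inv_smul_iff]
  let F : orbitRel.Quotient A X →
      orbitRel.Quotient A (FiberedBiset.tensor (twistBiset θ ν) X) :=
    Quotient.map τ (by
      rintro _ y ⟨a, rfl⟩
      exact ⟨a, (hτA a y).symm⟩)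
  have hF : Function.Bijective F := by
    constructor
    · intro c d
      refine Quotient.inductionOn₂ c d fun y z hyz => ?_
      obtain ⟨a, ha⟩ := FiberedSet.fiber_eq_iff.1 hyz
      rw [← hτA] at ha
      exact FiberedSet.fiber_eq_iff.2 ⟨a, hτ.1 ha⟩
    · intro c
      refine Quotient.inductionOn c fun z => ?_
      obtain ⟨y, rfl⟩ := hτ.2 z
      exact ⟨Quotient.mk _ y, rfl⟩
  have := Fintype.ofFinite (orbitRel.Quotient A X)
  have := Fintype.ofFinite (orbitRel.Quotient A (FiberedBiset.tensor (twistBiset θ ν) X))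
  rw [finsum_eq_sum_of_fintype, finsum_eq_sum_of_fintype, ← hF.sum_comp, Finset.mul_sum]
  refine Finset.sum_congr rfl fun c _ => ?_
  refine Quotient.inductionOn c fun y => ?_
  change graphSpecies ι ⊤ h ((FiberedBiset.tensor (twistBiset θ ν) X).fiberGraph (τ y)) =
    (ι (ν h) : k) * graphSpecies ι H (l : G) (X.fiberGraph y)
  by_cases hst : ∀ g ∈ H, ∃ a, (g, a) ∈ X.fiberGraph y
  · obtain ⟨a, ha⟩ := hst l l.2
    rw [graphSpecies_of_mem ι (fun a => FiberedSet.eq_one_of_mem_fiberGraph) hst ha,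
      graphSpecies_of_mem ι (fun a => FiberedSet.eq_one_of_mem_fiberGraph) (a := ν h * a)]
    · simp
    · intro g _
      obtain ⟨b, hb⟩ := hst (θ g) (hH ▸ ⟨g, rfl⟩)
      exact ⟨ν g * b, (hmem y g _).2 (by rwa [inv_mul_cancel_left])⟩
    · exact (hmem y h _).2 (by rwa [inv_mul_cancel_left, hl])
  · push Not at hst
    obtain ⟨g, hg, hg'⟩ := hst
    subst hH
    obtain ⟨m, rfl⟩ := hg
    rw [graphSpecies_of_not ι _ (MonoidHom.mem_range.2 ⟨m, rfl⟩) hg', mul_zero,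
      graphSpecies_of_not ι _ (Subgroup.mem_top m) fun a ha => hg' _ ((hmem y m a).1 ha)]

end Twist

/-! ### Fourier inversion, and minimal groups of subfunctors. -/

section Minimal

variable {A G : Type u} [CommGroup A] [Group G] {k : Type v} [Field k]

/-- Fourier inversion: a function on `G` constant modulo `O(G)` and orthogonal to all characters
with values in `A` vanishes. -/
theorem eq_zero_of_sum_character_eq_zero [Fintype G] (ι : A →* kˣ) (hι : Function.Injective ι)
    (hO : (Nat.card (homKernel A G) : k) ≠ 0) (u : G → k)
    (hu : ∀ g l, l⁻¹ * g ∈ homKernel A G → u l = u g)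
    (h : ∀ ν : G →* A, ∑ g, (ι (ν g) : k) * u g = 0) (g : G) : u g = 0 := by
  classical
  -- Duality: each `g` is viewed as a character of the group `G →* A`. Two elements give the same
  -- character exactly when they agree modulo `O(G)`.
  let ev : G → ((G →* A) →* k) := fun g =>
    (Units.coeHom k).comp (ι.comp (MonoidHom.eval g))
  have hev : ∀ g l, ev l = ev g ↔ l⁻¹ * g ∈ homKernel A G := by
    intro g l
    rw [mem_homKernel]
    constructor
    · intro h φ
      have := hι (Units.ext (DFunLike.congr_fun h φ))
      change φ l = φ g at this
      rw [map_mul, map_inv, this, inv_mul_cancel]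
    · intro h
      refine MonoidHom.ext fun φ => ?_
      have := h φ
      rw [map_mul, map_inv, inv_mul_eq_one] at this
      change (ι (φ l) : k) = ι (φ g)
      rw [this]
  -- The hypothesis is a linear relation among these evaluation characters, the coefficient of each
  -- being the sum of `u` over a coset of `O(G)`. By independence all these sums vanish.
  have h1 := linearIndependent_iff'.1 (linearIndependent_monoidHom (G →* A) k)
    (Finset.univ.image ev) (fun χ => ∑ l ∈ Finset.univ.filter (fun l => ev l = χ), u l) (by
      funext ν
      rw [Finset.sum_apply, Pi.zero_apply, ← h ν,
        ← Finset.sum_fiberwise_of_maps_to (t := Finset.univ.image ev) (g := ev)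
          fun l _ => Finset.mem_image_of_mem _ (Finset.mem_univ l)]
      refine Finset.sum_congr rfl fun χ _ => ?_
      rw [Pi.smul_apply, smul_eq_mul, Finset.sum_mul]
      refine Finset.sum_congr rfl fun l hl => ?_
      rw [← (Finset.mem_filter.1 hl).2, mul_comm]
      rfl) (ev g) (Finset.mem_image_of_mem _ (Finset.mem_univ g))
  have h2 : ∀ l ∈ Finset.univ.filter (fun l => ev l = ev g), u l = u g := fun l hl =>
    hu g l ((hev g l).1 (Finset.mem_filter.1 hl).2)
  -- The coset sum is therefore `|O(G)| u(g)`, and `|O(G)|` is invertible in `k`.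
  have h3 : (Finset.univ.filter (fun l => ev l = ev g)).card = Nat.card (homKernel A G) := by
    rw [← Fintype.card_subtype, ← Nat.card_eq_fintype_card]
    exact Nat.card_congr
      { toFun := fun l => ⟨l.1⁻¹ * g, (hev g l).1 l.2⟩
        invFun := fun o => ⟨g * (o : G)⁻¹, (hev _ _).2 (by simp)⟩
        left_inv := fun l => Subtype.ext (by simp)
        right_inv := fun o => Subtype.ext (by simp) }
  rw [Finset.sum_congr rfl h2, Finset.sum_const, h3, nsmul_eq_mul] at h1
  exact (mul_eq_zero.1 h1).resolve_left hO

theorem BurnsideSubfunctor.IsMinimalGroup.eq_bot {p : ℕ} {F : BurnsideSubfunctor p k A}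
    [Finite G] {hG : IsPGroup p G} (h : F.IsMinimalGroup G hG) (H : Type u) [Group H] [Finite H]
    (hH : IsPGroup p H) (hlt : Nat.card H < Nat.card G) : F.obj H hH = ⊥ := by
  by_contra hne
  exact hlt.not_ge (h.2 H hH hne)

/-- If `Φ(G)` were nontrivial, restrictions to proper subgroups and deflations to `G/Φ(G)` would
land in groups of smaller order, where `F` vanishes. Using the deflations of all twists by
characters of `G`, these operations kill every species of an element of `F(G)`. -/
theorem BurnsideSubfunctor.IsMinimalGroup.frattini_eq_bot {p : ℕ} [Fact p.Prime] [Finite A]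
    [Finite G] (ι : A →* kˣ) (hι : Function.Injective ι) (hk : (p : k) ≠ 0)
    {F : BurnsideSubfunctor p k A} {hG : IsPGroup p G} (h : F.IsMinimalGroup G hG) :
    frattini G = ⊥ := by
  by_contra hΦ
  refine h.1 ((Submodule.eq_bot_iff _).2 fun x hx => ?_)
  have := Fintype.ofFinite G
  have := Fintype.ofFinite (frattini G)
  have hΦk : (Nat.card (frattini G) : k) ≠ 0 := (hG.to_subgroup _).cast_card_ne_zero hk
  have hlt : Nat.card (G ⧸ frattini G) < Nat.card G := by
    rw [Subgroup.card_eq_card_quotient_mul_card_subgroup (frattini G)]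
    have h1 : 1 < Nat.card (frattini G) :=
      (Subgroup.one_lt_card_iff_ne_bot _).2 hΦ
    exact lt_mul_of_one_lt_right Nat.card_pos h1
  -- Restriction to `V` is the untwisted case `ν = 1` with `θ` the inclusion.
  have hproper : ∀ V : Subgroup G, V ≠ ⊤ → ∀ v : V, species ι V v x = 0 := by
    intro V hV v
    have hVlt : Nat.card V < Nat.card G :=
      lt_of_le_of_ne (Subgroup.card_le_card_group V) fun hc => hV (Subgroup.eq_top_of_card_eq V hc)
    have h1 := F.map_mem G V hG (hG.to_subgroup V) (twistBiset V.subtype 1) x hx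
    rw [h.eq_bot V (hG.to_subgroup V) hVlt, Submodule.mem_bot] at h1
    have h2 := species_top_twist ι V.subtype 1 V.range_subtype v v rfl x
    rw [h1, map_zero] at h2
    simpa using h2.symm
  -- The twist by `ν` stays in `F(G)` and its deflation vanishes, so the species weighted by `ν` sum
  -- to zero over every coset of `Φ(G)`.
  have hsum : ∀ ν : G →* A,
      ∑ g : G, (ι (ν g) : k) * species ι ⊤ ⟨g, Subgroup.mem_top g⟩ x = 0 := by
    intro ν
    have h1 := F.map_mem G G hG hG (twistBiset (MonoidHom.id G) ν) x hx
    have h2 := F.map_mem G _ hG (hG.to_quotient (frattini G)) (deflationBiset A (frattini G)) _ h1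
    rw [h.eq_bot _ (hG.to_quotient (frattini G)) hlt, Submodule.mem_bot] at h2
    have h3 : ∀ l : G, ∑ f : frattini G, (ι (ν (l * f)) : k) *
        species ι ⊤ ⟨l * f, Subgroup.mem_top _⟩ x = 0 := by
      intro l
      have h4 := species_top_deflation ι hι (frattini G) le_rfl hΦk l
        (FiberedBiset.map k (twistBiset (MonoidHom.id G) ν) x)
      rw [deflation, h2, map_zero, eq_comm, mul_eq_zero] at h4
      rw [← h4.resolve_left (inv_ne_zero hΦk)]
      refine Finset.sum_congr rfl fun f _ => ?_
      exact (species_top_twist ι (MonoidHom.id G) ν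
        (MonoidHom.range_eq_top.2 Function.surjective_id) (l * f) ⟨l * f, _⟩ rfl x).symm
    have h5 : ∑ l : G, ∑ f : frattini G, (ι (ν (l * f)) : k) *
        species ι ⊤ ⟨l * f, Subgroup.mem_top _⟩ x = 0 := Finset.sum_eq_zero fun l _ => h3 l
    -- For each fixed `f`, right translation by `f` turns the inner sum into the sum over `G`. The
    -- double sum is thus `|Φ(G)|` times the latter.
    rw [Finset.sum_comm] at h5
    have h6 : ∀ f : frattini G, ∑ l : G, (ι (ν (l * f)) : k) *
        species ι ⊤ ⟨l * f, Subgroup.mem_top _⟩ x =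
        ∑ g : G, (ι (ν g) : k) * species ι ⊤ ⟨g, Subgroup.mem_top g⟩ x := fun f =>
      Equiv.sum_comp (Equiv.mulRight (f : G))
        fun g : G => (ι (ν g) : k) * species ι ⊤ ⟨g, Subgroup.mem_top g⟩ x
    rw [Finset.sum_congr rfl fun f _ => h6 f, Finset.sum_const, nsmul_eq_mul, Finset.card_univ,
      ← Nat.card_eq_fintype_card] at h5
    exact (mul_eq_zero.1 h5).resolve_left hΦk
  have htop := eq_zero_of_sum_character_eq_zero ι hι
    ((hG.to_subgroup (homKernel A G)).cast_card_ne_zero hk)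
    (fun g => species ι ⊤ ⟨g, Subgroup.mem_top g⟩ x) (fun g l hgl => species_top_congr ι hgl x)
    hsum
  refine FiberedBurnside.eq_zero_of_species (hG.cast_card_ne_zero hk) ι hι x fun V v => ?_
  by_cases hV : V = ⊤
  · subst hV
    exact htop v
  · exact hproper V hV v

end Minimal

/-! ### Deflation of the idempotent, and the theorem. -/

section Main

variable {A G : Type u} [CommGroup A] [Group G] {k : Type v} [Field k]

/-- The solutions `f` form a coset of `O(G)`, which lies in `Φ(G)` because both `z` and `O(G)` do.
-/
theorem card_frattini_coset [Fintype (frattini G)] (hO : homKernel A G ≤ frattini G) {z : G}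
    (hz : z ∈ frattini G) [DecidablePred fun f : frattini G => (f : G)⁻¹ * z ∈ homKernel A G] :
    (Finset.univ.filter fun f : frattini G => (f : G)⁻¹ * z ∈ homKernel A G).card =
      Nat.card (homKernel A G) := by
  rw [← Fintype.card_subtype, ← Nat.card_eq_fintype_card]
  exact Nat.card_congr
    { toFun := fun f => ⟨(f.1 : G)⁻¹ * z, f.2⟩
      invFun := fun o => ⟨⟨z * (o : G)⁻¹, mul_mem hz (inv_mem (hO o.2))⟩, by simp⟩
      left_inv := fun f => Subtype.ext (Subtype.ext (by simp))
      right_inv := fun o => Subtype.ext (by simp) }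

/-- Both sides are compared through their species on `G/Φ(G)`: averages handle the pairs whose
subgroup is the whole quotient, and all other species vanish. -/
theorem deflation_idempotent {p : ℕ} [Fact p.Prime] [Finite A] [Finite G] (hG : IsPGroup p G)
    (hA : p ∣ Nat.card A) (hk : (p : k) ≠ 0) (ι : A →* kˣ) (hι : Function.Injective ι) (g : G)
    {e : FiberedBurnside k A G} {e' : FiberedBurnside k A (G ⧸ frattini G)}
    (he : IsIdempotentAt ι ⊤ ⟨g, Subgroup.mem_top g⟩ e)
    (he' : IsIdempotentAt ι ⊤ ⟨(g : G ⧸ frattini G), Subgroup.mem_top _⟩ e') :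
    deflation k A (frattini G) e = ((Nat.card (homKernel A G) : k) /
      (Nat.card (pairStabilizer A (⊤ : Subgroup G) ⟨g, Subgroup.mem_top g⟩) : k) *
      (Nat.card (G ⧸ frattini G) : k)) • e' := by
  classical
  have := Fintype.ofFinite (frattini G)
  have hGk := hG.cast_card_ne_zero hk
  have hQk := (hG.to_quotient (frattini G)).cast_card_ne_zero hk
  have hΦk : (Nat.card (frattini G) : k) ≠ 0 := (hG.to_subgroup _).cast_card_ne_zero hk
  -- The stabilizer of `(G, g)` is all of `G`, and `|G| = |G/Φ(G)| |Φ(G)|`.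
  have hcoef : (Nat.card (homKernel A G) : k) /
      (Nat.card (pairStabilizer A (⊤ : Subgroup G) ⟨g, Subgroup.mem_top g⟩) : k) *
      (Nat.card (G ⧸ frattini G) : k) =
      (Nat.card (frattini G) : k)⁻¹ * Nat.card (homKernel A G) := by
    rw [pairStabilizer_top, Nat.card_coe_set_eq, Set.ncard_univ,
      Subgroup.card_eq_card_quotient_mul_card_subgroup (frattini G)]
    push_cast
    field_simp
  rw [hcoef]
  obtain ⟨h1, h2⟩ := (isIdempotentAt_top_iff hGk ι hι g e).1 he
  obtain ⟨h1', h2'⟩ := (isIdempotentAt_top_iff hQk ι hι _ e').1 he'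
  refine FiberedBurnside.eq_of_species hQk ι hι fun K l => ?_
  rw [map_smul, smul_eq_mul]
  by_cases hK : K = ⊤
  · subst hK
    obtain ⟨q, hq⟩ := l
    obtain ⟨l, rfl⟩ := QuotientGroup.mk_surjective q
    rw [species_top_deflation ι hι (frattini G) le_rfl hΦk, mul_assoc]
    congr 1
    have hsp : ∀ m : G, species ι ⊤ ⟨m, Subgroup.mem_top m⟩ e =
        if m⁻¹ * g ∈ homKernel A G then 1 else 0 := by
      intro m
      split_ifs with h
      · rw [species_top_congr ι h, h1]
      · exact h2 ⊤ _ fun h' => h h'.2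
    simp only [hsp, mul_inv_rev, mul_assoc]
    rw [Finset.sum_boole]
    by_cases hlg : l⁻¹ * g ∈ frattini G
    · have hq : (l : G ⧸ frattini G) = g := QuotientGroup.eq.2 hlg
      rw [card_frattini_coset (hG.homKernel_le_frattini hA) hlg]
      simp only [hq, h1', mul_one]
    · rw [Finset.filter_false_of_mem, Finset.card_empty, Nat.cast_zero, h2', mul_zero]
      -- As `O(G/Φ(G))` is trivial, `e'` has species `0` at every `l Φ(G)` other than `g Φ(G)`.
      · rw [hG.homKernel_quotient_frattini hA, Subgroup.mem_bot, inv_mul_eq_one]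
        exact fun h => hlg (QuotientGroup.eq.1 h.2)
      · intro f _ hf
        refine hlg ?_
        rw [← mul_inv_cancel_left (f : G) (l⁻¹ * g)]
        exact mul_mem f.2 (hG.homKernel_le_frattini hA hf)
  · rw [h2' K l fun h => hK h.1, mul_zero]
    -- The preimage of a proper subgroup is proper, so every pair below it is different from `(G,
    -- g)` and has species `0` on `e`.
    refine species_deflation_eq_zero ι hι _ hΦk K l e fun V hV v => h2 V v fun h => hK ?_
    have h3 : K.comap (QuotientGroup.mk' (frattini G)) = ⊤ := top_unique (h.1 ▸ hV)
    rw [← Subgroup.comap_top (QuotientGroup.mk' (frattini G))] at h3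
    exact Subgroup.comap_injective (QuotientGroup.mk'_surjective _) h3

end Main

theorem mainTheorem6 {p n : ℕ} (hp : p.Prime) (hn : 0 < n) {A : Type u} [CommGroup A]
    [IsCyclic A] (hA : Nat.card A = p ^ n) {k : Type v} [Field k] (hk : (p : k) ≠ 0)
    (ι : A →* kˣ) (hι : Function.Injective ι) :
    (∀ (G : Type u) [Group G] [Finite G], IsPGroup p G → ∀ g : G,
      (∃! e : FiberedBurnside k A G, IsIdempotentAt ι ⊤ ⟨g, Subgroup.mem_top g⟩ e) ∧
      (∃! e : FiberedBurnside k A (G ⧸ frattini G),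
        IsIdempotentAt ι ⊤ ⟨(g : G ⧸ frattini G), Subgroup.mem_top _⟩ e) ∧
      ∀ (e : FiberedBurnside k A G) (e' : FiberedBurnside k A (G ⧸ frattini G)),
        IsIdempotentAt ι ⊤ ⟨g, Subgroup.mem_top g⟩ e →
        IsIdempotentAt ι ⊤ ⟨(g : G ⧸ frattini G), Subgroup.mem_top _⟩ e' →
        deflation k A (frattini G) e =
          ((Nat.card (homKernel A G) : k) /
            (Nat.card (pairStabilizer A (⊤ : Subgroup G) ⟨g, Subgroup.mem_top g⟩) : k) *
            (Nat.card (G ⧸ frattini G) : k)) • e') ∧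
    (∀ (F : BurnsideSubfunctor p k A) (G : Type u) [Group G] [Finite G] (hG : IsPGroup p G),
      F.IsMinimalGroup G hG → IsElementaryAbelian p G) := by
  have : Fact p.Prime := ⟨hp⟩
  -- `Nat.card` is `0` on infinite types, so the order `p ^ n` forces finiteness.
  have : Finite A := Nat.finite_of_card_ne_zero (hA ▸ pow_ne_zero n hp.ne_zero)
  have hpA : p ∣ Nat.card A := hA ▸ dvd_pow_self p hn.ne'
  exact ⟨fun G _ _ hG g => ⟨existsUnique_isIdempotentAt_top hG hk ι hι g,
      existsUnique_isIdempotentAt_top (hG.to_quotient _) hk ι hι _,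
      fun e e' he he' => deflation_idempotent hG hpA hk ι hι g he he'⟩,
    fun F G _ _ hG hF => hG.isElementaryAbelian_of_frattini_eq_bot A hpA
      (hF.frattini_eq_bot ι hι hk)⟩
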